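/- \textbf{Theorem (1-color stable matching).} Let $d\ge 1$. There is a constant $C=C(d)\in(0,\infty)$ such that the following holds for every Poisson process of intensity $1$ in $\mathbb R^d$, with random set of points $R$. A \emph{partial matching} of a set $U\subset\mathbb R^d$ is the edge set $m$ of a simple graph with vertex set $U$ in which every vertex has degree at most $1$; write $m(x)$ for the partner of $x$, and put $|x-m(x)|:=\infty$ if $x$ is unmatched. It is \emph{stable} if there are no distinct $x,y\in U$ with $|x-y|<\min\{|x-m(x)|,|y-m(y)|\}$, where $|\cdot|$ is the Euclidean norm. Almost surely $R$ has exactly one stable partial matching $\mathcal M$, and $\mathcal M$ leaves no point of $R$ unmatched. Let $X$ be the typical distance from a point to its partner in $\mathcal M$, that is, a $[0,\infty]$-valued random variable, under a probability measure $\mathbb P^*$ with expectation $\mathbb E^*$, with distribution function $$\mathbb P^*(X\le r)=\mathbb E\,\#\{x\in R\cap[0,1)^d:\ |x-\mathcal M(x)|\le r\},\qquad r\in[0,\infty]$$ (the right-hand side is indeed a distribution function). Then \begin{enumerate} \item[(i)] $\mathbb E^*X^d=\infty$; \item[(ii)] $\mathbb P^*(X>r)\le C\,r^{-d}$ for all $r>0$.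 \end{enumerate} -/

import Mathlib

open MeasureTheory ProbabilityTheory
open scoped ENNReal

namespace StableMatching

/-- Euclidean space `ℝ^d` with the Euclidean distance and Lebesgue measure. -/
abbrev Space (d : ℕ) : Type := EuclideanSpace ℝ (Fin d)

/-- The unit cube `[0,1)^d`. -/
def unitCube (d : ℕ) : Set (Space d) := {x | ∀ i, 0 ≤ x i ∧ x i < 1}

/-- The random set `R` of points of `ℝ^d`, defined on `(Ω, P)`, is (the support of) a homogeneous
Poisson process of intensity `1`: the numbers of points in Borel sets are random variables, the
number of points in a Borel set of finite Lebesgue measure `v` has the Poisson law of mean `v`,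
and the numbers of points in disjoint Borel sets are independent. In particular `R` is almost
surely locally finite. -/
structure IsUnitPoissonProcess {d : ℕ} {Ω : Type*} [MeasurableSpace Ω] (P : Measure Ω)
    (R : Ω → Set (Space d)) : Prop where
  measurable_count : ∀ B : Set (Space d), MeasurableSet B →
    Measurable fun ω => ((R ω ∩ B).encard : ℝ≥0∞)
  count_law : ∀ B : Set (Space d), MeasurableSet B → volume B ≠ ∞ → ∀ n : ℕ,
    P {ω | (R ω ∩ B).encard = n} = poissonMeasure (volume B).toNNReal {n}
  indep_count : ∀ (k : ℕ) (B : Fin k → Set (Space d)), (∀ i, MeasurableSet (B i)) →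
    Pairwise (fun i j => Disjoint (B i) (B j)) →
    iIndepFun (fun (i : Fin k) ω => ((R ω ∩ B i).encard : ℝ≥0∞)) P

/-- `m` is a partial matching of the set `U`: its edges join points of `U`, and every point has
degree at most one. -/
def IsPartialMatching {d : ℕ} (U : Set (Space d)) (m : SimpleGraph (Space d)) : Prop :=
  (∀ x y, m.Adj x y → x ∈ U ∧ y ∈ U) ∧ ∀ x y z, m.Adj x y → m.Adj x z → y = z

/-- The distance `|x - m(x)|` from `x` to its partner in the matching `m`; it is `∞` if `x` is
unmatched (an infimum over the empty set). -/
noncomputable def partnerDist {d : ℕ} (m : SimpleGraph (Space d)) (x : Space d) : ℝ≥0∞ :=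
  ⨅ (y : Space d) (_ : m.Adj x y), edist x y

/-- `m` is a stable partial matching of `U`: there are no distinct `x, y ∈ U` that are both
strictly closer to each other than to their partners. -/
def IsStableMatching {d : ℕ} (U : Set (Space d)) (m : SimpleGraph (Space d)) : Prop :=
  IsPartialMatching U m ∧
    ¬ ∃ x ∈ U, ∃ y ∈ U, x ≠ y ∧ edist x y < min (partnerDist m x) (partnerDist m y)

/-- `m` leaves no point of `U` unmatched. -/
def MatchesAll {d : ℕ} (U : Set (Space d)) (m : SimpleGraph (Space d)) : Prop :=
  ∀ x ∈ U, ∃ y, m.Adj x y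

/-- The number of points `x ∈ U ∩ [0,1)^d` with `|x - m(x)| ≤ r`. -/
noncomputable def closeCount {d : ℕ} (U : Set (Space d)) (m : SimpleGraph (Space d))
    (r : ℝ≥0∞) : ℝ≥0∞ :=
  ({x | x ∈ U ∩ unitCube d ∧ partnerDist m x ≤ r}.encard : ℝ≥0∞)

/-- `μ` is the law `P*(X ∈ ·)` of the typical distance `X` from a point of `R` to its partner in
the random matching `M`, that is, the probability measure on `[0,∞]` with distribution function
`P*(X ≤ r) = F(r) = E #{x ∈ R ∩ [0,1)^d : |x - M(x)| ≤ r}`. The counts are required to be random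
variables (up to null sets), so that the expectations have their usual meaning. -/
structure IsTypicalDistLaw {d : ℕ} {Ω : Type*} [MeasurableSpace Ω] (P : Measure Ω)
    (R : Ω → Set (Space d)) (M : Ω → SimpleGraph (Space d)) (μ : Measure ℝ≥0∞) : Prop where
  aemeasurable_count : ∀ r : ℝ≥0∞, AEMeasurable (fun ω => closeCount (R ω) (M ω) r) P
  isProbabilityMeasure : IsProbabilityMeasure μ
  cdf_eq : ∀ r : ℝ≥0∞, μ (Set.Iic r) = ∫⁻ ω, closeCount (R ω) (M ω) r ∂P

end StableMatching

namespace StableMatching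

/-! ### Dyadic cubes and annuli -/

section Geometry

variable {d : ℕ}

/-- The index of the dyadic cube of side `2⁻ⁿ` that contains `x`. -/
noncomputable def cell (n : ℕ) (x : Space d) : Fin d → ℤ := fun i => ⌊(2 : ℝ) ^ n * x i⌋

/-- The half-open dyadic cube of side `2⁻ⁿ` with index `v`. -/
def cube (n : ℕ) (v : Fin d → ℤ) : Set (Space d) := {x | cell n x = v}

lemma mem_cube {n : ℕ} {v : Fin d → ℤ} {x : Space d} : x ∈ cube n v ↔ cell n x = v := Iff.rfl

lemma measurable_coord (i : Fin d) : Measurable fun x : Space d => x i :=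
  (EuclideanSpace.proj (𝕜 := ℝ) i).continuous.measurable

lemma measurable_cell (n : ℕ) : Measurable (cell n : Space d → Fin d → ℤ) :=
  measurable_pi_lambda _ fun i => Int.measurable_floor.comp ((measurable_coord i).const_mul _)

lemma measurableSet_cube (n : ℕ) (v : Fin d → ℤ) : MeasurableSet (cube n v) :=
  measurable_cell n (measurableSet_singleton v)

lemma disjoint_cube {n : ℕ} {v w : Fin d → ℤ} (h : v ≠ w) : Disjoint (cube n v) (cube n w) :=
  Set.disjoint_left.2 fun _ hx hy => h (hx.symm.trans hy)

lemma unitCube_eq_cube : unitCube d = cube 0 0 := by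
  ext x
  simp only [unitCube, cube, cell, Set.mem_ofPred_eq, funext_iff, pow_zero, one_mul, Pi.zero_apply,
    Int.floor_eq_zero_iff, Set.mem_Ico]

lemma cube_eq_preimage (n : ℕ) (v : Fin d → ℤ) :
    cube n v = (MeasurableEquiv.toLp 2 (Fin d → ℝ)).symm ⁻¹'
      (Set.univ.pi fun i => Set.Ico ((v i : ℝ) / 2 ^ n) (((v i : ℝ) + 1) / 2 ^ n)) := by
  ext x
  simp only [cube, cell, Set.mem_ofPred_eq, funext_iff, Set.mem_preimage, Set.mem_pi, Set.mem_univ,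
    true_implies, Set.mem_Ico, Int.floor_eq_iff]
  refine forall_congr' fun i => ?_
  have h2 : (0 : ℝ) < 2 ^ n := by positivity
  rw [div_le_iff₀ h2, lt_div_iff₀ h2, mul_comm]
  rfl

lemma volume_cube (n : ℕ) (v : Fin d → ℤ) :
    volume (cube n v) = ENNReal.ofReal ((1 / 2 ^ n) ^ d) := by
  rw [cube_eq_preimage, (EuclideanSpace.volume_preserving_symm_measurableEquiv_toLp
    (Fin d)).measure_preimage_equiv, Real.volume_pi_Ico]
  have : ∀ i : Fin d, ((v i : ℝ) + 1) / 2 ^ n - (v i : ℝ) / 2 ^ n = 1 / 2 ^ n := fun i => by ring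
  simp only [this, Finset.prod_const, Finset.card_univ, Fintype.card_fin]
  rw [ENNReal.ofReal_pow (by positivity)]

lemma volume_unitCube : volume (unitCube d) = 1 := by
  rw [unitCube_eq_cube, volume_cube]; simp

lemma measurableSet_unitCube : MeasurableSet (unitCube d) := by
  rw [unitCube_eq_cube]; exact measurableSet_cube _ _

lemma dist_le_sqrt_mul {x y : Space d} {s : ℝ} (hs : 0 ≤ s) (h : ∀ i, |x i - y i| ≤ s) :
    dist x y ≤ √d * s := by
  rw [EuclideanSpace.dist_eq]
  calc √(∑ i, dist (x i) (y i) ^ 2) ≤ √(∑ _i : Fin d, s ^ 2) := by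
        apply Real.sqrt_le_sqrt
        refine Finset.sum_le_sum fun i _ => ?_
        rw [Real.dist_eq]
        exact pow_le_pow_left₀ (abs_nonneg _) (h i) 2
    _ = √d * s := by
        rw [Finset.sum_const, Finset.card_univ, Fintype.card_fin, nsmul_eq_mul,
          Real.sqrt_mul (by positivity), Real.sqrt_sq hs]

lemma dist_le_of_cell_eq {n : ℕ} {x y : Space d} (h : cell n x = cell n y) :
    dist x y ≤ √d * (1 / 2 ^ n) := by
  refine dist_le_sqrt_mul (by positivity) fun i => ?_
  have h2 : (0 : ℝ) < 2 ^ n := by positivity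
  have := (Int.abs_sub_lt_one_of_floor_eq_floor (congrFun h i)).le
  rw [← mul_sub, abs_mul, abs_of_pos h2] at this
  rwa [le_div_iff₀ h2, mul_comm]

lemma exists_cell_scale {ε : ℝ} (hε : 0 < ε) : ∃ n₀ : ℕ, ∀ n ≥ n₀, √d * (1 / 2 ^ n) ≤ ε := by
  have h : Filter.Tendsto (fun n : ℕ => √d * (1 / 2 : ℝ) ^ n) Filter.atTop (nhds (√d * 0)) :=
    (tendsto_pow_atTop_nhds_zero_of_lt_one (by norm_num) (by norm_num)).const_mul _
  rw [mul_zero] at h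
  obtain ⟨n₀, h₀⟩ := Filter.eventually_atTop.1 (h.eventually_lt_const hε)
  exact ⟨n₀, fun n hn => by simpa [div_pow] using (h₀ n hn).le⟩

lemma exists_cell_ne {x y : Space d} (h : x ≠ y) : ∃ n₀ : ℕ, ∀ n ≥ n₀, cell n x ≠ cell n y := by
  obtain ⟨n₀, h₀⟩ := exists_cell_scale (d := d) (half_pos (dist_pos.2 h))
  refine ⟨n₀, fun n hn hc => ?_⟩
  have := (dist_le_of_cell_eq hc).trans (h₀ n hn)
  linarith [dist_pos.2 h]

/-- The closed annulus with centre `c` and radii `a ≤ b`. -/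
def annulus (c : Space d) (a b : ℝ) : Set (Space d) := {y | a ≤ dist c y ∧ dist c y ≤ b}

lemma volume_annulus_le (hd : 1 ≤ d) (c : Space d) {a b : ℝ} (ha : 0 ≤ a) (hab : a ≤ b) :
    volume (annulus c a b) ≤
      ENNReal.ofReal (b ^ d - a ^ d) * volume (Metric.ball (0 : Space d) 1) := by
  have : Nonempty (Fin d) := ⟨⟨0, hd⟩⟩
  have hsub : annulus c a b ⊆ Metric.closedBall c b \ Metric.ball c a := fun y hy =>
    ⟨by rw [Metric.mem_closedBall, dist_comm]; exact hy.2,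
      by rw [Metric.mem_ball, dist_comm, not_lt]; exact hy.1⟩
  refine (measure_mono hsub).trans ?_
  rw [measure_sdiff (Metric.ball_subset_closedBall.trans (Metric.closedBall_subset_closedBall hab))
    measurableSet_ball.nullMeasurableSet measure_ball_lt_top.ne,
    Measure.addHaar_closedBall _ _ (ha.trans hab), Measure.addHaar_ball _ _ ha,
    finrank_euclideanSpace, Fintype.card_fin, ENNReal.ofReal_sub _ (by positivity),
    ENNReal.sub_mul fun _ _ => measure_ball_lt_top.ne]

lemma exists_thin_annulus (hd : 1 ≤ d) (K : ℝ) {κ : ℝ≥0∞} (hκ : 0 < κ) :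
    ∃ η : ℝ, 0 < η ∧ ∀ (c : Space d) (a b : ℝ), a ≤ b → b ≤ K → b - a ≤ η →
      volume (annulus c a b) ≤ κ := by
  set V := volume (Metric.ball (0 : Space d) 1) with hV
  have hVtop : V ≠ ∞ := measure_ball_lt_top.ne
  obtain ⟨δ, hδ, hδκ⟩ : ∃ δ : ℝ, 0 < δ ∧ ENNReal.ofReal δ * V ≤ κ := by
    by_cases h : κ = ∞
    · exact ⟨1, one_pos, h ▸ le_top⟩
    refine ⟨κ.toReal / (V.toReal + 1), by
      have := ENNReal.toReal_pos hκ.ne' h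
      positivity, ?_⟩
    rw [← ENNReal.ofReal_toReal hVtop, ← ENNReal.ofReal_mul (by positivity)]
    refine ENNReal.ofReal_le_of_le_toReal ?_
    rw [ENNReal.toReal_ofReal ENNReal.toReal_nonneg, div_mul_eq_mul_div,
      div_le_iff₀ (by positivity)]
    nlinarith [ENNReal.toReal_nonneg (a := κ), ENNReal.toReal_nonneg (a := V)]
  have huc : UniformContinuousOn (fun x : ℝ => x ^ d) (Set.Icc 0 K) :=
    isCompact_Icc.uniformContinuousOn_of_continuous (continuous_pow d).continuousOn
  obtain ⟨η, hη, h⟩ := Metric.uniformContinuousOn_iff.1 huc δ hδ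
  refine ⟨η / 2, half_pos hη, fun c a b hab hbK hη' => ?_⟩
  by_cases hb : b < 0
  · have : annulus c a b = ∅ := by
      ext y
      simp only [annulus, Set.mem_ofPred_eq, Set.mem_empty_iff_false, iff_false, not_and, not_le]
      exact fun _ => hb.trans_le dist_nonneg
    simp [this]
  push Not at hb
  have hsub : annulus c a b ⊆ annulus c (max a 0) b := fun y hy => ⟨max_le hy.1 dist_nonneg, hy.2⟩
  have hm : max a 0 ≤ b := max_le hab hb
  refine (measure_mono hsub).trans ((volume_annulus_le hd c (le_max_right _ _) hm).trans ?_)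
  refine le_trans ?_ hδκ
  gcongr
  have h3 := h b ⟨hb, hbK⟩ (max a 0) ⟨le_max_right _ _, hm.trans hbK⟩ (by
    rw [Real.dist_eq, abs_of_nonneg (by linarith)]
    linarith [le_max_left a 0])
  exact (le_abs_self _).trans (Real.dist_eq _ _ ▸ h3).le

end Geometry

/-! ### Stable matchings of a deterministic set -/

section Deterministic

variable {d : ℕ}

/-- `U` has finitely many points in every ball. -/
def LocFin (U : Set (Space d)) : Prop := ∀ n : ℕ, (U ∩ Metric.closedBall 0 n).Finite

/-- The edge `f` joins two points of `U`, shares an endpoint with `e` and is shorter than `e`. -/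
def Shorter (U : Set (Space d)) (f e : Space d × Space d) : Prop :=
  (f.1 = e.1 ∨ f.1 = e.2) ∧ f.1 ∈ U ∧ f.2 ∈ U ∧ f.1 ≠ f.2 ∧ dist f.1 f.2 < dist e.1 e.2

/-- The edges that are accepted (first component) and rejected (second component) after `n` rounds:
an edge is accepted when all shorter adjacent edges are rejected, and rejected when
some shorter adjacent edge is accepted. -/
def stage (U : Set (Space d)) : ℕ → (Space d × Space d → Prop) × (Space d × Space d → Prop)
  | 0 => (fun _ => False, fun _ => False)
  | n + 1 => (fun e => ∀ f, Shorter U f e → (stage U n).2 f,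
      fun e => ∃ f, Shorter U f e ∧ (stage U n).1 f)

/-- The edge `e` is accepted at some round. -/
def Accepted (U : Set (Space d)) (e : Space d × Space d) : Prop := ∃ n, (stage U n).1 e

/-- The edge `e` is rejected at some round. -/
def Rejected (U : Set (Space d)) (e : Space d × Space d) : Prop := ∃ n, (stage U n).2 e

lemma stage_mono_succ (U : Set (Space d)) (n : ℕ) :
    (∀ e, (stage U n).1 e → (stage U (n + 1)).1 e) ∧
      ∀ e, (stage U n).2 e → (stage U (n + 1)).2 e := by
  induction n with
  | zero => exact ⟨fun _ h => h.elim, fun _ h => h.elim⟩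
  | succ n ih =>
    exact ⟨fun e h f hf => ih.2 f (h f hf), fun e ⟨f, hf, h⟩ => ⟨f, hf, ih.1 f h⟩⟩

lemma stage_fst_mono {U : Set (Space d)} {m n : ℕ} (h : m ≤ n) {e : Space d × Space d}
    (he : (stage U m).1 e) : (stage U n).1 e := by
  induction n, h using Nat.le_induction with
  | base => exact he
  | succ n _ ih => exact (stage_mono_succ U n).1 e ih

lemma stage_snd_mono {U : Set (Space d)} {m n : ℕ} (h : m ≤ n) {e : Space d × Space d}
    (he : (stage U m).2 e) : (stage U n).2 e := by
  induction n, h using Nat.le_induction with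
  | base => exact he
  | succ n _ ih => exact (stage_mono_succ U n).2 e ih

lemma shorter_swap {U : Set (Space d)} {f e : Space d × Space d} :
    Shorter U f e.swap ↔ Shorter U f e := by
  simp only [Shorter, Prod.fst_swap, Prod.snd_swap, dist_comm e.2 e.1, or_comm]

lemma Accepted.swap {U : Set (Space d)} {e : Space d × Space d} (h : Accepted U e) :
    Accepted U e.swap := by
  obtain ⟨n, hn⟩ := h
  refine ⟨n, ?_⟩
  cases n with
  | zero => exact hn
  | succ n => exact fun f hf => hn f (shorter_swap.1 hf)

/-- The graph of accepted edges. -/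
def matchGraph (U : Set (Space d)) : SimpleGraph (Space d) where
  Adj x y := x ∈ U ∧ y ∈ U ∧ x ≠ y ∧ Accepted U (x, y)
  symm := ⟨fun _ _ ⟨hx, hy, hne, h⟩ => ⟨hy, hx, hne.symm, h.swap⟩⟩
  loopless := ⟨fun _ h => h.2.2.1 rfl⟩

/-- No point of `U` is equidistant from two other points of `U`. -/
def NoIsosceles (U : Set (Space d)) : Prop :=
  ∀ x ∈ U, ∀ y ∈ U, ∀ z ∈ U, x ≠ y → x ≠ z → y ≠ z → dist x y ≠ dist x z

/-- The properties of a set of points that make its stable matching exist and be unique. -/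
structure Good (U : Set (Space d)) : Prop where
  locFin : LocFin U
  noIsosceles : NoIsosceles U
  wf : WellFounded (Shorter U)

lemma LocFin.mono {U V : Set (Space d)} (hU : LocFin U) (h : V ⊆ U) : LocFin V :=
  fun n => (hU n).subset (Set.inter_subset_inter_left _ h)

lemma LocFin.finite_inter {U B : Set (Space d)} (hU : LocFin U) (hB : Bornology.IsBounded B) :
    (U ∩ B).Finite := by
  obtain ⟨r, hr⟩ := hB.subset_closedBall 0
  obtain ⟨n, hn⟩ := exists_nat_ge r
  exact (hU n).subset (Set.inter_subset_inter_right _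
    (hr.trans (Metric.closedBall_subset_closedBall hn)))

lemma Shorter.mono {U V : Set (Space d)} (h : V ⊆ U) {f e : Space d × Space d}
    (hf : Shorter V f e) : Shorter U f e :=
  ⟨hf.1, h hf.2.1, h hf.2.2.1, hf.2.2.2⟩

lemma Good.mono {U V : Set (Space d)} (hU : Good U) (h : V ⊆ U) : Good V where
  locFin := hU.locFin.mono h
  noIsosceles x hx y hy z hz := hU.noIsosceles x (h hx) y (h hy) z (h hz)
  wf := Subrelation.wf (fun hf => Shorter.mono h hf) hU.wf

lemma LocFin.finite_shorter {U : Set (Space d)} (hU : LocFin U) (e : Space d × Space d) :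
    {f | Shorter U f e}.Finite := by
  refine (Set.Finite.prod (Set.toFinite {e.1, e.2})
    (hU.finite_inter (B := Metric.closedBall e.1 (2 * dist e.1 e.2))
      Metric.isBounded_closedBall)).subset ?_
  rintro ⟨x, y⟩ ⟨h1, hx, hy, _, hlt⟩
  refine ⟨h1, hy, ?_⟩
  simp only at h1 hlt
  rw [Metric.mem_closedBall]
  rcases h1 with rfl | rfl
  · rw [dist_comm]; linarith [dist_nonneg (x := e.1) (y := e.2)]
  · have := dist_triangle y e.2 e.1
    rw [dist_comm y e.2, dist_comm e.2 e.1] at this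
    simp only
    linarith

lemma Good.accepted_or_rejected {U : Set (Space d)} (hU : Good U) (e : Space d × Space d) :
    Accepted U e ∨ Rejected U e := by
  induction e using hU.wf.induction with
  | _ e ih =>
  by_cases h : ∃ f, Shorter U f e ∧ Accepted U f
  · obtain ⟨f, hf, n, hn⟩ := h
    exact Or.inr ⟨n + 1, f, hf, hn⟩
  · push Not at h
    have hrej : ∀ f, Shorter U f e → ∃ n, (stage U n).2 f := fun f hf =>
      (ih f hf).resolve_left (h f hf)
    choose! N hN using hrej
    obtain ⟨m, hm⟩ := ((hU.locFin.finite_shorter e).image N).bddAbove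
    exact Or.inl ⟨m + 1, fun f hf => stage_snd_mono (hm ⟨f, hf, rfl⟩) (hN f hf)⟩

lemma not_stage_and {U : Set (Space d)} (n : ℕ) (e : Space d × Space d) :
    ¬ ((stage U n).1 e ∧ (stage U n).2 e) := by
  induction n generalizing e with
  | zero => exact fun h => h.1
  | succ n ih => exact fun ⟨h1, f, hf, h2⟩ => ih f ⟨h2, h1 f hf⟩

lemma Accepted.not_rejected {U : Set (Space d)} {e : Space d × Space d} (h : Accepted U e) :
    ¬ Rejected U e := by
  rintro ⟨n, hn⟩
  obtain ⟨m, hm⟩ := h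
  exact not_stage_and (max m n) e
    ⟨stage_fst_mono (le_max_left _ _) hm, stage_snd_mono (le_max_right _ _) hn⟩

lemma Accepted.rejected_of_shorter {U : Set (Space d)} {e f : Space d × Space d}
    (h : Accepted U e) (hf : Shorter U f e) : Rejected U f := by
  obtain ⟨n, hn⟩ := h
  cases n with
  | zero => exact hn.elim
  | succ n => exact ⟨n, hn f hf⟩

lemma Rejected.exists_shorter {U : Set (Space d)} {e : Space d × Space d} (h : Rejected U e) :
    ∃ f, Shorter U f e ∧ Accepted U f := by
  obtain ⟨n, hn⟩ := h
  cases n with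
  | zero => exact hn.elim
  | succ n =>
    obtain ⟨f, hf, h⟩ := hn
    exact ⟨f, hf, n, h⟩

lemma IsPartialMatching.partnerDist_eq {U : Set (Space d)} {m : SimpleGraph (Space d)}
    (hm : IsPartialMatching U m) {x y : Space d} (h : m.Adj x y) : partnerDist m x = edist x y := by
  refine le_antisymm (iInf₂_le y h) (le_iInf₂ fun z hz => ?_)
  rw [hm.2 x y z h hz]

lemma partnerDist_eq_top {m : SimpleGraph (Space d)} {x : Space d} (h : ∀ y, ¬ m.Adj x y) :
    partnerDist m x = ∞ := by
  simp [partnerDist, h]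

lemma isStableMatching_matchGraph {U : Set (Space d)} (hU : Good U) :
    IsStableMatching U (matchGraph U) := by
  refine ⟨⟨fun x y h => ⟨h.1, h.2.1⟩, ?_⟩, ?_⟩
  · rintro x y z ⟨hx, hy, hxy, h1⟩ ⟨_, hz, hxz, h2⟩
    by_contra hyz
    rcases (hU.noIsosceles x hx y hy z hz hxy hxz hyz).lt_or_gt with hlt | hlt
    · exact h1.not_rejected (h2.rejected_of_shorter ⟨Or.inl rfl, hx, hy, hxy, hlt⟩)
    · exact h2.not_rejected (h1.rejected_of_shorter ⟨Or.inl rfl, hx, hz, hxz, hlt⟩)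
  · rintro ⟨x, hx, y, hy, hxy, hlt⟩
    rw [lt_min_iff] at hlt
    rcases hU.accepted_or_rejected (x, y) with h | h
    · exact (iInf₂_le (f := fun z (_ : (matchGraph U).Adj x z) => edist x z) y
        ⟨hx, hy, hxy, h⟩).not_gt hlt.1
    · obtain ⟨⟨w, z⟩, ⟨hw, hwU, hzU, hne, hwz⟩, hacc⟩ := h.exists_shorter
      have h1 : partnerDist (matchGraph U) w ≤ edist w z :=
        iInf₂_le (f := fun z (_ : (matchGraph U).Adj w z) => edist w z) z ⟨hwU, hzU, hne, hacc⟩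
      have h2 : edist w z < edist x y := by
        rw [edist_dist, edist_dist]
        exact (ENNReal.ofReal_lt_ofReal_iff_of_nonneg dist_nonneg).2 hwz
      rcases hw with hw | hw <;> simp only at hw <;> subst hw
      · exact (h1.trans_lt h2).not_gt hlt.1
      · exact (h1.trans_lt h2).not_gt hlt.2

lemma IsStableMatching.eq_matchGraph {U : Set (Space d)} (hU : Good U) {m : SimpleGraph (Space d)}
    (hm : IsStableMatching U m) : m = matchGraph U := by
  have key : ∀ e : Space d × Space d, e.1 ∈ U → e.2 ∈ U → e.1 ≠ e.2 →
      (m.Adj e.1 e.2 ↔ Accepted U e) := by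
    intro e
    induction e using hU.wf.induction with
    | _ e ih =>
    obtain ⟨x, y⟩ := e
    intro hx hy hxy
    simp only at hx hy hxy ⊢
    constructor
    · intro hadj
      refine (hU.accepted_or_rejected (x, y)).resolve_right fun hr => ?_
      obtain ⟨⟨w, z⟩, hs, hacc⟩ := hr.exists_shorter
      have hwz := (ih _ hs hs.2.1 hs.2.2.1 hs.2.2.2.1).2 hacc
      obtain ⟨hw, hwU, hzU, hne, hlt⟩ := hs
      simp only at hw hwz hlt
      rcases hw with hw | hw <;> subst hw
      · rw [hm.1.2 _ _ _ hwz hadj] at hlt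
        exact lt_irrefl _ hlt
      · rw [hm.1.2 _ _ _ hwz hadj.symm, dist_comm] at hlt
        exact lt_irrefl _ hlt
    · intro hacc
      by_contra hnadj
      have hfar : ∀ u v, (u = x ∧ v = y) ∨ (u = y ∧ v = x) → edist x y < partnerDist m u := by
        intro u v huv
        by_cases hmu : ∃ z, m.Adj u z
        · obtain ⟨z, hz⟩ := hmu
          rw [hm.1.partnerDist_eq hz, edist_dist, edist_dist,
            ENNReal.ofReal_lt_ofReal_iff_of_nonneg dist_nonneg]
          have huU := (hm.1.1 u z hz).1
          have hzU := (hm.1.1 u z hz).2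
          have hvU : v ∈ U := by rcases huv with ⟨_, rfl⟩ | ⟨_, rfl⟩ <;> assumption
          have huv' : u ≠ v := by
            rcases huv with ⟨rfl, rfl⟩ | ⟨rfl, rfl⟩
            · exact hxy
            · exact hxy.symm
          have hzv : v ≠ z := by
            rintro rfl
            rcases huv with ⟨rfl, rfl⟩ | ⟨rfl, rfl⟩
            · exact hnadj hz
            · exact hnadj hz.symm
          have hd : dist x y = dist u v := by
            rcases huv with ⟨rfl, rfl⟩ | ⟨rfl, rfl⟩
            · rfl
            · exact dist_comm _ _
          rw [hd]
          refine lt_of_le_of_ne (not_lt.1 fun hlt => ?_)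
            (hU.noIsosceles u huU v hvU z hzU huv' hz.ne hzv)
          have hs : Shorter U (u, z) (x, y) := by
            refine ⟨?_, huU, hzU, hz.ne, hd ▸ hlt⟩
            rcases huv with ⟨rfl, _⟩ | ⟨rfl, _⟩
            · exact Or.inl rfl
            · exact Or.inr rfl
          exact ((ih _ hs huU hzU hz.ne).1 hz).not_rejected (hacc.rejected_of_shorter hs)
        · push Not at hmu
          rw [partnerDist_eq_top hmu]
          exact edist_lt_top _ _
      exact hm.2 ⟨x, hx, y, hy, hxy, lt_min (hfar x y (Or.inl ⟨rfl, rfl⟩))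
        (hfar y x (Or.inr ⟨rfl, rfl⟩))⟩
  ext x y
  constructor
  · intro h
    obtain ⟨hx, hy⟩ := hm.1.1 x y h
    exact ⟨hx, hy, h.ne, (key (x, y) hx hy h.ne).1 h⟩
  · rintro ⟨hx, hy, hne, h⟩
    exact (key (x, y) hx hy hne).2 h

lemma Good.existsUnique {U : Set (Space d)} (hU : Good U) :
    ∃! m : SimpleGraph (Space d), IsStableMatching U m :=
  ⟨matchGraph U, isStableMatching_matchGraph hU, fun _ hm => hm.eq_matchGraph hU⟩

/-- The distance from `x` to its partner in the graph of accepted edges. -/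
noncomputable def pd (U : Set (Space d)) (x : Space d) : ℝ≥0∞ := partnerDist (matchGraph U) x

lemma shorter_translate {U : Set (Space d)} (z : Space d) {f e : Space d × Space d} :
    Shorter ((· + z) '' U) (f + (z, z)) (e + (z, z)) ↔ Shorter U f e := by
  have hmem : ∀ x : Space d, x + z ∈ (· + z) '' U ↔ x ∈ U := fun x =>
    (add_left_injective z).mem_set_image
  simp [Shorter, -Set.image_add_right, hmem]

lemma stage_translate (U : Set (Space d)) (z : Space d) (n : ℕ) :
    (∀ e, (stage ((· + z) '' U) n).1 (e + (z, z)) ↔ (stage U n).1 e) ∧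
      ∀ e, (stage ((· + z) '' U) n).2 (e + (z, z)) ↔ (stage U n).2 e := by
  have hsurj : Function.Surjective (fun f : Space d × Space d => f + (z, z)) :=
    (Equiv.addRight (z, z)).surjective
  induction n with
  | zero => exact ⟨fun _ => Iff.rfl, fun _ => Iff.rfl⟩
  | succ n ih =>
    refine ⟨fun e => ?_, fun e => ?_⟩
    · simp only [stage]
      rw [hsurj.forall]
      simp only [shorter_translate, ih.2]
    · simp only [stage]
      rw [hsurj.exists]
      simp only [shorter_translate, ih.1]

lemma matchGraph_translate_adj (U : Set (Space d)) (z x y : Space d) :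
    (matchGraph ((· + z) '' U)).Adj (x + z) (y + z) ↔ (matchGraph U).Adj x y := by
  have hmem : ∀ x : Space d, x + z ∈ (· + z) '' U ↔ x ∈ U := fun x =>
    (add_left_injective z).mem_set_image
  have hacc : Accepted ((· + z) '' U) (x + z, y + z) ↔ Accepted U (x, y) :=
    exists_congr fun n => (stage_translate U z n).1 (x, y)
  simp only [matchGraph, hmem, hacc, ne_eq, add_left_inj]

lemma pd_translate (U : Set (Space d)) (z x : Space d) :
    pd ((· + z) '' U) (x + z) = pd U x := by
  have hsurj : Function.Surjective (fun f : Space d => f + z) := (Equiv.addRight z).surjective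
  simp only [pd, partnerDist]
  rw [← hsurj.iInf_comp]
  simp only [matchGraph_translate_adj, edist_add_right]

lemma le_edist_of_far {U : Set (Space d)} (hU : Good U) {x y : Space d} (hx : x ∈ U) (hy : y ∈ U)
    (hxy : x ≠ y) {r : ℝ≥0∞} (hrx : r < pd U x) (hry : r < pd U y) : r ≤ edist x y := by
  by_contra! h
  exact (isStableMatching_matchGraph hU).2 ⟨x, hx, y, hy, hxy, lt_min (h.trans hrx) (h.trans hry)⟩

lemma pd_eq_of_adj {U : Set (Space d)} (hU : Good U) {x y : Space d}
    (h : (matchGraph U).Adj x y) : pd U x = edist x y :=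
  (isStableMatching_matchGraph hU).1.partnerDist_eq h

lemma exists_adj_of_pd_ne_top {U : Set (Space d)} {x : Space d} (h : pd U x ≠ ∞) :
    ∃ y, (matchGraph U).Adj x y := by
  by_contra! hx
  exact h (partnerDist_eq_top hx)

lemma pd_pos {U : Set (Space d)} (hU : Good U) (x : Space d) : 0 < pd U x := by
  by_cases h : pd U x = ∞
  · simp [h]
  · obtain ⟨y, hy⟩ := exists_adj_of_pd_ne_top h
    rw [pd_eq_of_adj hU hy]
    exact edist_pos.2 hy.ne

/-- Removing a union of matched pairs and unmatched points does not change the other pairs. -/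
lemma pd_sdiff {U D : Set (Space d)} (hU : Good U)
    (hD : ∀ x ∈ D, ∀ y, (matchGraph U).Adj x y → y ∈ D) {x : Space d} (hx : x ∈ U \ D) :
    pd (U \ D) x = pd U x := by
  set m := matchGraph U with hm
  have hst := isStableMatching_matchGraph hU
  let m' : SimpleGraph (Space d) :=
    { Adj := fun x y => m.Adj x y ∧ x ∉ D ∧ y ∉ D
      symm := ⟨fun _ _ h => ⟨h.1.symm, h.2.2, h.2.1⟩⟩
      loopless := ⟨fun x h => m.loopless.irrefl x h.1⟩ }
  have hadj : ∀ x ∉ D, ∀ y, m'.Adj x y ↔ m.Adj x y := fun x hx y =>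
    ⟨fun h => h.1, fun h => ⟨h, hx, fun hy => hx (hD y hy x h.symm)⟩⟩
  have hpd : ∀ x ∉ D, partnerDist m' x = partnerDist m x := fun x hx => by
    simp only [partnerDist, hadj x hx]
  have hm' : IsStableMatching (U \ D) m' := by
    refine ⟨⟨fun x y h => ?_, fun x y z h1 h2 => hst.1.2 x y z h1.1 h2.1⟩, ?_⟩
    · obtain ⟨hx, hy⟩ := hst.1.1 x y h.1
      exact ⟨⟨hx, h.2.1⟩, ⟨hy, h.2.2⟩⟩
    · rintro ⟨x, hx, y, hy, hxy, hlt⟩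
      rw [hpd x hx.2, hpd y hy.2] at hlt
      exact hst.2 ⟨x, hx.1, y, hy.1, hxy, hlt⟩
  rw [pd, ← hm'.eq_matchGraph (hU.mono Set.sdiff_subset), hpd x hx.2, pd]

/-- A new point whose distance to each point `x` is at least `pd V x` stays unmatched. -/
lemma pd_insert_eq_top {V : Set (Space d)} {u : Space d} (hU : Good (insert u V)) (hu : u ∉ V)
    (h : ∀ x ∈ V, pd V x ≤ edist x u) : pd (insert u V) u = ∞ := by
  have hV := hU.mono (Set.subset_insert u V)
  have hst := isStableMatching_matchGraph hV
  have hm : IsStableMatching (insert u V) (matchGraph V) := by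
    refine ⟨⟨fun x y hxy => ?_, hst.1.2⟩, ?_⟩
    · exact ⟨Or.inr hxy.1, Or.inr hxy.2.1⟩
    · rintro ⟨x, hx, y, hy, hxy, hlt⟩
      rw [lt_min_iff] at hlt
      rcases hx with rfl | hx
      · rcases hy with rfl | hy
        · exact hxy rfl
        · exact (h y hy).not_gt (edist_comm x y ▸ hlt.2)
      · rcases hy with rfl | hy
        · exact (h x hx).not_gt hlt.1
        · exact hst.2 ⟨x, hx, y, hy, hxy, lt_min hlt.1 hlt.2⟩
  rw [pd, ← hm.eq_matchGraph hU]
  exact partnerDist_eq_top fun y hy => hu hy.1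

end Deterministic

/-! ### A sufficient condition for the absence of descending chains -/

section Descending

variable {d : ℕ}

/-- The paths with `k` steps that start within distance `m` of the origin and whose
steps have lengths between `a` and `b`. -/
def pathSet (d : ℕ) (a b : ℝ) (m : ℕ) (k : ℕ) : Set (Fin (k + 1) → Space d) :=
  {x | x 0 ∈ Metric.closedBall 0 m ∧
    ∀ i : Fin k, a ≤ dist (x i.castSucc) (x i.succ) ∧ dist (x i.castSucc) (x i.succ) ≤ b}

/-- All annuli with radii slightly beyond `a` and `b` have volume at most `1 / 2`. -/
def Thin (d : ℕ) (a b : ℝ) : Prop :=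
  ∃ ε > 0, ∀ c : Space d, volume (annulus c (a - ε) (b + ε)) ≤ 1 / 2

lemma exists_thin (hd : 1 ≤ d) (l : ℝ) : ∃ a b : ℚ, (a : ℝ) < l ∧ l < b ∧ Thin d a b := by
  obtain ⟨η, hη, h⟩ := exists_thin_annulus hd (l + 1) (κ := 1 / 2) (by simp)
  have hm : 0 < min η 1 := lt_min hη one_pos
  obtain ⟨a, ha1, ha2⟩ := exists_rat_btwn (show l - min η 1 / 4 < l by linarith)
  obtain ⟨b, hb1, hb2⟩ := exists_rat_btwn (show l < l + min η 1 / 4 by linarith)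
  refine ⟨a, b, ha2, hb1, min η 1 / 4, by linarith, fun c => h c _ _ ?_ ?_ ?_⟩ <;>
    linarith [min_le_left η 1, min_le_right η 1]

lemma dist_le_mul_length {G : SimpleGraph (Space d)} {b : ℝ} (hG : ∀ x y, G.Adj x y → dist x y ≤ b)
    {x y : Space d} (p : G.Walk x y) : dist x y ≤ b * p.length := by
  induction p with
  | nil => simp
  | cons h p ih =>
    rw [SimpleGraph.Walk.length_cons]
    push_cast
    linarith [dist_triangle _ _ _ |>.trans (add_le_add (hG _ _ h) ih)]

lemma wf_shorter_of_no_path (hd : 1 ≤ d) {U : Set (Space d)} (hU : LocFin U)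
    (h : ∀ a b : ℚ, Thin d a b → ∀ m : ℕ, ∃ k : ℕ,
      ¬ ∃ x ∈ pathSet d a b m k, Function.Injective x ∧ ∀ i, x i ∈ U) :
    WellFounded (Shorter U) := by
  rw [wellFounded_iff_isEmpty_descending_chain]
  refine ⟨fun ⟨f, hf⟩ => ?_⟩
  set L : ℕ → ℝ := fun n => dist (f n).1 (f n).2 with hL
  have hanti : StrictAnti L := strictAnti_nat_of_succ_lt fun n => (hf n).2.2.2.2
  have hbdd : BddBelow (Set.range L) := ⟨0, by rintro _ ⟨n, rfl⟩; exact dist_nonneg⟩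
  have hlim := tendsto_atTop_ciInf hanti.antitone hbdd
  obtain ⟨a, b, ha, hb, hthin⟩ := exists_thin hd (⨅ n, L n)
  obtain ⟨N, hN⟩ := Filter.eventually_atTop.1 ((hlim.eventually_lt_const hb))
  have hwin : ∀ n ≥ N, (a : ℝ) ≤ L n ∧ L n ≤ b := fun n hn =>
    ⟨ha.le.trans (ciInf_le hbdd n), (hN n hn).le⟩
  let G : SimpleGraph (Space d) :=
    { Adj := fun x y => (x ∈ U ∧ y ∈ U ∧ x ≠ y) ∧ (a : ℝ) ≤ dist x y ∧ dist x y ≤ b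
      symm := ⟨fun x y h => ⟨⟨h.1.2.1, h.1.1, h.1.2.2.symm⟩, dist_comm x y ▸ h.2⟩⟩
      loopless := ⟨fun x h => h.1.2.2 rfl⟩ }
  have hadj : ∀ n ≥ N, G.Adj (f (n + 1)).1 (f (n + 1)).2 := fun n hn =>
    ⟨⟨(hf n).2.1, (hf n).2.2.1, (hf n).2.2.2.1⟩, hwin (n + 1) (by omega)⟩
  set x₀ := (f (N + 1)).1 with hx₀
  have hreach : ∀ n ≥ N, G.Reachable x₀ (f (n + 1)).1 ∧ G.Reachable x₀ (f (n + 1)).2 := by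
    intro n hn
    induction n, hn using Nat.le_induction with
    | base => exact ⟨SimpleGraph.Reachable.refl _, (hadj N le_rfl).reachable⟩
    | succ n hn ih =>
      have h1 : G.Reachable x₀ (f (n + 1 + 1)).1 := by
        rcases (hf (n + 1)).1 with h1 | h1 <;> rw [h1]
        exacts [ih.1, ih.2]
      exact ⟨h1, h1.trans (hadj (n + 1) (by omega)).reachable⟩
  have hunb : ∀ r : ℝ, ∃ n ≥ N, r < dist x₀ (f (n + 1)).1 := by
    intro r
    by_contra! hr
    have hfin := (hU.finite_inter (B := Metric.closedBall x₀ (r + b))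
      Metric.isBounded_closedBall)
    have hmaps : ∀ n, f (N + n + 1) ∈ (U ∩ Metric.closedBall x₀ (r + b)) ×ˢ
        (U ∩ Metric.closedBall x₀ (r + b)) := by
      intro n
      have h1 := hr (N + n) (by omega)
      have h2 := (hwin (N + n + 1) (by omega)).2
      have h3 := dist_triangle x₀ (f (N + n + 1)).1 (f (N + n + 1)).2
      have h4 : 0 ≤ L (N + n + 1) := dist_nonneg
      refine ⟨⟨(hf (N + n)).2.1, ?_⟩, ⟨(hf (N + n)).2.2.1, ?_⟩⟩ <;>
        rw [Metric.mem_closedBall, dist_comm]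
      · linarith
      · exact h3.trans (add_le_add h1 h2)
    refine Set.infinite_of_injective_forall_mem (f := fun n => f (N + n + 1)) ?_ hmaps
      (hfin.prod hfin)
    intro i j hij
    have : L (N + i + 1) = L (N + j + 1) := congrArg (fun e : Space d × Space d => dist e.1 e.2) hij
    have := hanti.injective this
    omega
  obtain ⟨m, hm⟩ := exists_nat_ge (dist x₀ 0)
  obtain ⟨k, hk⟩ := h a b hthin m
  have hb0 : (0 : ℝ) ≤ b := dist_nonneg.trans (hwin N le_rfl).2
  obtain ⟨n, hn, hfar⟩ := hunb (b * k)
  obtain ⟨p⟩ := (hreach n hn).1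
  classical
  have hpath := p.toPath.2
  set q : G.Walk x₀ (f (n + 1)).1 := p.toPath.1 with hq
  have hlen : k < q.length := by
    have h1 := hfar.trans_le (dist_le_mul_length (G := G) (b := b) (fun x y h => h.2.2) q)
    have h2 := lt_of_mul_lt_mul_left h1 hb0
    exact_mod_cast h2
  have hstep : ∀ i < q.length, G.Adj (q.getVert i) (q.getVert (i + 1)) := fun i hi =>
    q.adj_getVert_succ hi
  refine hk ⟨fun i => q.getVert i, ⟨?_, fun i => ?_⟩, fun i j hij => ?_, fun i => ?_⟩
  · simpa using hm
  · exact (hstep i (by omega)).2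
  · have := hpath.getVert_injOn (show (i : ℕ) ≤ q.length by omega)
      (show (j : ℕ) ≤ q.length by omega) hij
    exact Fin.ext this
  · exact (hstep i (by omega)).1.1

end Descending

/-! ### Almost surely the points of a Poisson process are in general position -/

section Discretisation

variable {d : ℕ}

/-- The tuples of cubes of side `2⁻ⁿ` that are met by the tuples of points in `A`. -/
def disc (n : ℕ) {k : ℕ} (A : Set (Fin k → Space d)) : Set (Fin k → Fin d → ℤ) :=
  {t | ∃ x ∈ A, ∀ i, cell n (x i) = t i}

/-- The volume of the union of the products of the cubes in the tuples of `S`. -/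
noncomputable def mass (n : ℕ) {k : ℕ} (S : Set (Fin k → Fin d → ℤ)) : ℝ≥0∞ :=
  ∑' t, S.indicator (fun _ => volume (cube n (0 : Fin d → ℤ)) ^ k) t

lemma mass_zero_le (n : ℕ) (S : Set (Fin 0 → Fin d → ℤ)) : mass n S ≤ 1 := by
  rw [mass, tsum_eq_single default (fun t ht => (ht (Subsingleton.elim _ _)).elim)]
  simpa using Set.indicator_le_self' (s := S) (f := fun _ => (1 : ℝ≥0∞)) (by simp) default

lemma tsum_indicator_volume_cube (n : ℕ) (T : Set (Fin d → ℤ)) :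
    ∑' v, T.indicator (fun _ => volume (cube n (0 : Fin d → ℤ))) v =
      volume (cell n ⁻¹' T : Set (Space d)) := by
  have h : (cell n ⁻¹' T : Set (Space d)) = ⋃ v : T, cube n v := by
    ext x; simp [mem_cube]
  rw [h, measure_iUnion (fun v w hvw => disjoint_cube fun h => hvw (Subtype.ext h))
    (fun v => measurableSet_cube n _), ← tsum_subtype]
  simp only [volume_cube]

lemma mass_succ_le {n k : ℕ} {A : Set (Fin (k + 1) → Space d)} {A' : Set (Fin k → Space d)}
    {κ : ℝ≥0∞} (h₁ : ∀ x ∈ A, Fin.init x ∈ A')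
    (h₂ : ∀ x' ∈ A', volume {y | ∃ x ∈ A, (∀ i, cell n (x i.castSucc) = cell n (x' i)) ∧
      cell n (x (Fin.last k)) = cell n y} ≤ κ) :
    mass n (disc n A) ≤ κ * mass n (disc n A') := by
  rw [mass, ← (Fin.snocEquiv fun _ : Fin (k + 1) => Fin d → ℤ).tsum_eq, ENNReal.tsum_prod',
    ENNReal.tsum_comm, mass, ← ENNReal.tsum_mul_left]
  refine ENNReal.tsum_le_tsum fun t' => ?_
  by_cases ht' : t' ∈ disc n A'
  · rw [Set.indicator_of_mem ht']
    obtain ⟨x', hx', hc⟩ := ht'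
    calc _ ≤ ∑' v, ({v | (Fin.snoc (α := fun _ => Fin d → ℤ) t' v) ∈ disc n A} :
              Set (Fin d → ℤ)).indicator (fun _ => volume (cube n (0 : Fin d → ℤ))) v *
              volume (cube n (0 : Fin d → ℤ)) ^ k := by
            refine ENNReal.tsum_le_tsum fun v => ?_
            by_cases hv : (Fin.snoc (α := fun _ => Fin d → ℤ) t' v) ∈ disc n A
            · rw [Set.indicator_of_mem (s := {v | (Fin.snoc (α := fun _ => Fin d → ℤ) t' v) ∈ disc n A})
                hv, ← pow_succ']
              exact Set.indicator_le_self' (by simp) _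
            · have : Fin.snocEquiv (fun _ : Fin (k + 1) => Fin d → ℤ) (v, t') ∉ disc n A := hv
              rw [Set.indicator_of_notMem this]
              exact zero_le
      _ ≤ _ := by
            rw [ENNReal.tsum_mul_right, tsum_indicator_volume_cube]
            gcongr
            refine (measure_mono fun y hy => ?_).trans (h₂ x' hx')
            obtain ⟨x, hx, hxt⟩ := hy
            refine ⟨x, hx, fun i => ?_, ?_⟩
            · rw [hxt, Fin.snoc_castSucc, hc]
            · rw [hxt, Fin.snoc_last]
  · have : ∀ v, Fin.snocEquiv (fun _ : Fin (k + 1) => Fin d → ℤ) (v, t') ∉ disc n A := by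
      rintro v ⟨x, hx, hxt⟩
      refine ht' ⟨Fin.init x, h₁ x hx, fun i => ?_⟩
      have := hxt i.castSucc
      simpa [Fin.init, Fin.snocEquiv] using this
    simp [Set.indicator_of_notMem (this _)]

variable {Ω : Type*} [MeasurableSpace Ω] {P : Measure Ω} [IsProbabilityMeasure P]
  {R : Ω → Set (Space d)}

lemma IsUnitPoissonProcess.prob_nonempty_le (hR : IsUnitPoissonProcess P R) {B : Set (Space d)}
    (hB : MeasurableSet B) (hv : volume B ≠ ∞) : P {ω | (R ω ∩ B).Nonempty} ≤ volume B := by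
  have h0 := hR.count_law B hB hv 0
  rw [poissonMeasure_singleton] at h0
  have hset : {ω | (R ω ∩ B).Nonempty} = {ω | (R ω ∩ B).encard = ((0 : ℕ) : ℕ∞)}ᶜ := by
    ext ω
    simp [Set.nonempty_iff_ne_empty]
  have hmeas : MeasurableSet {ω | (R ω ∩ B).encard = ((0 : ℕ) : ℕ∞)} := by
    have : {ω | (R ω ∩ B).encard = ((0 : ℕ) : ℕ∞)} =
        (fun ω => ((R ω ∩ B).encard : ℝ≥0∞)) ⁻¹' {0} := by
      ext ω; simp
    rw [this]
    exact hR.measurable_count B hB (measurableSet_singleton 0)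
  rw [hset, prob_compl_eq_one_sub hmeas, h0]
  have h1 := Real.add_one_le_exp (-((volume B).toNNReal : ℝ))
  rw [← ENNReal.ofReal_toReal hv]
  simp only [pow_zero, Nat.factorial_zero, Nat.cast_one, div_one, mul_one]
  rw [← ENNReal.ofReal_one, ← ENNReal.ofReal_sub _ (Real.exp_pos _).le]
  apply ENNReal.ofReal_le_ofReal
  have : ((volume B).toNNReal : ℝ) = (volume B).toReal := rfl
  rw [ENNReal.ofReal_toReal hv]
  linarith

lemma IsUnitPoissonProcess.prob_occupied_le (hR : IsUnitPoissonProcess P R) (n : ℕ) {k : ℕ}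
    {t : Fin k → Fin d → ℤ} (ht : Function.Injective t) :
    P {ω | ∀ i, (R ω ∩ cube n (t i)).Nonempty} ≤ volume (cube n (0 : Fin d → ℤ)) ^ k := by
  have hind := hR.indep_count k (fun i => cube n (t i)) (fun i => measurableSet_cube _ _)
    fun i j hij => disjoint_cube (ht.ne hij)
  have hset : ∀ i, {ω | (R ω ∩ cube n (t i)).Nonempty} =
      (fun ω => ((R ω ∩ cube n (t i)).encard : ℝ≥0∞)) ⁻¹' {0}ᶜ := by
    intro i
    ext ω
    simp [Set.nonempty_iff_ne_empty]
  have h1 := (iIndepFun_iff_measure_inter_preimage_eq_mul.1 hind) Finset.univ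
    (sets := fun _ => {0}ᶜ) (fun i _ => (measurableSet_singleton 0).compl)
  have h2 : {ω | ∀ i, (R ω ∩ cube n (t i)).Nonempty} = ⋂ i ∈ Finset.univ,
      (fun ω => ((R ω ∩ cube n (t i)).encard : ℝ≥0∞)) ⁻¹' {0}ᶜ := by
    simp only [← hset, Finset.mem_univ, Set.iInter_true]
    ext ω; simp
  rw [h2, h1]
  calc _ ≤ ∏ _i : Fin k, volume (cube n (0 : Fin d → ℤ)) := by
        refine Finset.prod_le_prod' fun i _ => ?_
        rw [← hset]
        refine (hR.prob_nonempty_le (measurableSet_cube _ _) ?_).trans_eq ?_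
        · rw [volume_cube]; exact ENNReal.ofReal_ne_top
        · rw [volume_cube, volume_cube]
    _ = _ := by simp

lemma IsUnitPoissonProcess.prob_tuple_le (hR : IsUnitPoissonProcess P R) {k : ℕ}
    (A : Set (Fin k → Space d)) {c : ℝ≥0∞} {n₀ : ℕ} (h : ∀ n ≥ n₀, mass n (disc n A) ≤ c) :
    P {ω | ∃ x ∈ A, Function.Injective x ∧ ∀ i, x i ∈ R ω} ≤ c := by
  set E : ℕ → Set Ω := fun n => ⋃ t : {t : Fin k → Fin d → ℤ // t ∈ disc n A ∧
    Function.Injective t}, {ω | ∀ i, (R ω ∩ cube n (t.1 i)).Nonempty} with hE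
  have hPE : ∀ n ≥ n₀, P (E n) ≤ c := by
    intro n hn
    refine le_trans ?_ (h n hn)
    refine (measure_iUnion_le _).trans ?_
    refine (ENNReal.tsum_le_tsum fun t => hR.prob_occupied_le n t.2.2).trans ?_
    rw [mass]
    refine le_trans ?_ (ENNReal.tsum_comp_le_tsum_of_injective
      (f := (Subtype.val : {t : Fin k → Fin d → ℤ // t ∈ disc n A ∧ Function.Injective t} → _))
      Subtype.val_injective _)
    refine ENNReal.tsum_le_tsum fun t => ?_
    rw [Set.indicator_of_mem t.2.1]
  have hsub : {ω | ∃ x ∈ A, Function.Injective x ∧ ∀ i, x i ∈ R ω} ⊆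
      ⋃ N : ℕ, ⋂ n ≥ max N n₀, E n := by
    rintro ω ⟨x, hx, hinj, hmem⟩
    have hsep : ∀ p : Fin k × Fin k, ∃ N, ∀ n ≥ N, p.1 ≠ p.2 → cell n (x p.1) ≠ cell n (x p.2) := by
      intro p
      by_cases hp : p.1 = p.2
      · exact ⟨0, fun n _ h => (h hp).elim⟩
      · obtain ⟨N, hN⟩ := exists_cell_ne (hinj.ne hp)
        exact ⟨N, fun n hn _ => hN n hn⟩
    choose N hN using hsep
    obtain ⟨M, hM⟩ := (Set.finite_range N).bddAbove
    refine Set.mem_iUnion.2 ⟨M, Set.mem_iInter₂.2 fun n hn => ?_⟩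
    refine Set.mem_iUnion.2 ⟨⟨fun i => cell n (x i), ⟨x, hx, fun i => rfl⟩, fun i j hij => ?_⟩,
      fun i => ⟨x i, hmem i, rfl⟩⟩
    by_contra hne
    exact hN (i, j) n ((hM ⟨(i, j), rfl⟩).trans ((le_max_left _ _).trans hn)) hne hij
  refine (measure_mono hsub).trans ?_
  have hmono : Monotone fun N : ℕ => ⋂ n ≥ max N n₀, E n := fun N N' hNN' =>
    Set.biInter_mono (fun n (hn : n ≥ max N' n₀) => (max_le_max_right n₀ hNN').trans hn)
      fun _ _ => subset_rfl
  rw [hmono.measure_iUnion]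
  exact iSup_le fun N => (measure_mono (Set.iInter₂_subset (max N n₀) le_rfl)).trans
    (hPE _ (le_max_right _ _))

lemma volume_near_le {n : ℕ} {c : Space d} {r : ℝ} (hn : √d * (1 / 2 ^ n) ≤ 1) {T : Set (Space d)}
    (hT : ∀ y ∈ T, ∃ x ∈ Metric.closedBall c r, cell n x = cell n y) :
    volume T ≤ volume (Metric.closedBall c (r + 1)) := by
  refine measure_mono fun y hy => ?_
  obtain ⟨x, hx, hc⟩ := hT y hy
  have h1 := (dist_le_of_cell_eq hc).trans hn
  rw [Metric.mem_closedBall] at hx ⊢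
  linarith [dist_triangle_left y c x]

lemma mass_pathSet_le {a b ε : ℝ} (hε : ∀ c : Space d, volume (annulus c (a - ε) (b + ε)) ≤ 1 / 2)
    (m k : ℕ) {n : ℕ} (h1 : √d * (1 / 2 ^ n) ≤ 1) (h2 : √d * (1 / 2 ^ n) ≤ ε / 2) :
    mass n (disc n (pathSet d a b m k)) ≤
      (1 / 2) ^ k * volume (Metric.closedBall (0 : Space d) (m + 1)) := by
  induction k with
  | zero =>
    rw [pow_zero, one_mul]
    refine (mass_succ_le (A' := Set.univ) (κ := volume (Metric.closedBall (0 : Space d) (m + 1)))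
      (fun _ _ => Set.mem_univ _) fun x' _ => ?_).trans ?_
    · refine volume_near_le h1 ?_
      rintro y ⟨x, hx, -, hy⟩
      exact ⟨x 0, hx.1, hy⟩
    · exact mul_le_of_le_one_right' (mass_zero_le _ _)
  | succ k ih =>
    refine (mass_succ_le (A' := pathSet d a b m k) (κ := 1 / 2) ?_ ?_).trans ?_
    · rintro x ⟨hx0, hx⟩
      exact ⟨hx0, fun i => hx i.castSucc⟩
    · rintro x' -
      refine (measure_mono ?_).trans (hε (x' (Fin.last k)))
      rintro y ⟨x, ⟨-, hx⟩, hc, hy⟩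
      have d1 := (dist_le_of_cell_eq (hc (Fin.last k))).trans h2
      have d2 := (dist_le_of_cell_eq hy).trans h2
      have d3 := hx (Fin.last k)
      rw [Fin.succ_last] at d3
      have t1 := dist_triangle4 (x' (Fin.last k)) (x (Fin.last k).castSucc) (x (Fin.last (k + 1))) y
      have t2 := dist_triangle4 (x (Fin.last k).castSucc) (x' (Fin.last k)) y (x (Fin.last (k + 1)))
      rw [dist_comm (x' (Fin.last k)) (x (Fin.last k).castSucc)] at t1
      rw [dist_comm y] at t2
      constructor <;> linarith
    · rw [pow_succ', mul_assoc]
      gcongr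

lemma eq_zero_of_le_half_pow {p V : ℝ≥0∞} (hV : V ≠ ∞) (h : ∀ k : ℕ, p ≤ (1 / 2) ^ k * V) :
    p = 0 := by
  have h1 : Filter.Tendsto (fun k : ℕ => (1 / 2 : ℝ≥0∞) ^ k * V) Filter.atTop (nhds (0 * V)) :=
    ENNReal.Tendsto.mul_const (ENNReal.tendsto_pow_atTop_nhds_zero_of_lt_one (by simp)) (Or.inr hV)
  rw [zero_mul] at h1
  exact le_antisymm (ge_of_tendsto' h1 h) zero_le

lemma IsUnitPoissonProcess.ae_no_path (hR : IsUnitPoissonProcess P R) {a b : ℝ} (h : Thin d a b)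
    (m : ℕ) :
    ∀ᵐ ω ∂P, ∃ k : ℕ, ¬ ∃ x ∈ pathSet d a b m k, Function.Injective x ∧ ∀ i, x i ∈ R ω := by
  obtain ⟨ε, hε, hvol⟩ := h
  obtain ⟨n₀, h₀⟩ := exists_cell_scale (d := d) (show 0 < min 1 (ε / 2) by positivity)
  rw [ae_iff]
  refine eq_zero_of_le_half_pow (V := volume (Metric.closedBall (0 : Space d) (m + 1)))
    measure_closedBall_lt_top.ne fun k => ?_
  refine (measure_mono ?_).trans (hR.prob_tuple_le (pathSet d a b m k) (n₀ := n₀) fun n hn =>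
    mass_pathSet_le hvol m k ((h₀ n hn).trans (min_le_left _ _))
      ((h₀ n hn).trans (min_le_right _ _)))
  intro ω hω
  simp only [not_exists, not_not, Set.mem_ofPred_eq, not_forall] at hω
  exact hω k

/-- The isosceles triples within distance `m` of the origin. -/
def isoscelesSet (d m : ℕ) : Set (Fin 3 → Space d) :=
  {x | (∀ i, x i ∈ Metric.closedBall 0 m) ∧ dist (x 0) (x 1) = dist (x 0) (x 2)}

lemma mass_ball_le (m k : ℕ) {n : ℕ} (h1 : √d * (1 / 2 ^ n) ≤ 1) :
    mass n (disc n {x : Fin k → Space d | ∀ i, x i ∈ Metric.closedBall 0 m}) ≤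
      volume (Metric.closedBall (0 : Space d) (m + 1)) ^ k := by
  induction k with
  | zero => simpa using mass_zero_le _ _
  | succ k ih =>
    refine (mass_succ_le (A' := {x : Fin k → Space d | ∀ i, x i ∈ Metric.closedBall 0 m})
      (κ := volume (Metric.closedBall (0 : Space d) (m + 1)))
      (fun x (hx : ∀ i, x i ∈ Metric.closedBall 0 m) i => hx i.castSucc) fun x' _ =>
        volume_near_le (c := 0) (r := m) h1 ?_).trans ?_
    · rintro y ⟨x, hx, -, hy⟩
      exact ⟨_, hx _, hy⟩
    · rw [pow_succ']
      gcongr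

lemma mass_isoscelesSet_le {m : ℕ} {κ : ℝ≥0∞} {η : ℝ}
    (hη : ∀ (c : Space d) (a b : ℝ), a ≤ b → b ≤ 2 * m + 1 → b - a ≤ η →
      volume (annulus c a b) ≤ κ) {n : ℕ} (h1 : √d * (1 / 2 ^ n) ≤ 1)
    (h2 : √d * (1 / 2 ^ n) ≤ 1 / 4) (h3 : √d * (1 / 2 ^ n) ≤ η / 8) :
    mass n (disc n (isoscelesSet d m)) ≤
      κ * volume (Metric.closedBall (0 : Space d) (m + 1)) ^ 2 := by
  refine (mass_succ_le (A' := {x : Fin 2 → Space d | ∀ i, x i ∈ Metric.closedBall 0 m})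
    (κ := κ) (fun x hx i => hx.1 i.castSucc) fun x' hx' => ?_).trans ?_
  · set s := √d * (1 / 2 ^ n) with hs
    have hs0 : 0 ≤ s := by positivity
    have hρ : dist (x' 0) (x' 1) ≤ 2 * m := by
      have a1 := Metric.mem_closedBall.1 (hx' 0)
      have a2 := Metric.mem_closedBall.1 (hx' 1)
      linarith [dist_triangle_right (x' 0) (x' 1) 0]
    refine (measure_mono ?_).trans (hη (x' 0) (dist (x' 0) (x' 1) - 4 * s)
      (dist (x' 0) (x' 1) + 4 * s) (by linarith) (by linarith) (by linarith))
    rintro y ⟨x, ⟨-, hx⟩, hc, hy⟩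
    have d0 : dist (x 0) (x' 0) ≤ s := dist_le_of_cell_eq (hc 0)
    have d1 : dist (x 1) (x' 1) ≤ s := dist_le_of_cell_eq (hc 1)
    have d2 : dist (x 2) y ≤ s := dist_le_of_cell_eq hy
    have t1 := dist_triangle4 (x' 0) (x 0) (x 2) y
    have t2 := dist_triangle4 (x 0) (x' 0) y (x 2)
    have t3 := dist_triangle4 (x' 0) (x 0) (x 1) (x' 1)
    have t4 := dist_triangle4 (x 0) (x' 0) (x' 1) (x 1)
    rw [dist_comm (x' 0) (x 0)] at t1 t3
    rw [dist_comm y] at t2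
    rw [dist_comm (x' 1) (x 1)] at t4
    constructor <;> linarith
  · gcongr
    exact mass_ball_le m 2 h1

lemma IsUnitPoissonProcess.ae_noIsosceles (hd : 1 ≤ d) (hR : IsUnitPoissonProcess P R) :
    ∀ᵐ ω ∂P, NoIsosceles (R ω) := by
  have key : ∀ m : ℕ, ∀ᵐ ω ∂P,
      ¬ ∃ x ∈ isoscelesSet d m, Function.Injective x ∧ ∀ i, x i ∈ R ω := by
    intro m
    rw [ae_iff]
    simp only [not_not]
    refine eq_zero_of_le_half_pow (V := volume (Metric.closedBall (0 : Space d) (m + 1)) ^ 2)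
      (ENNReal.pow_ne_top measure_closedBall_lt_top.ne) fun k => ?_
    obtain ⟨η, hη, hvol⟩ := exists_thin_annulus hd (2 * m + 1) (κ := (1 / 2) ^ k)
      (by simp [pos_iff_ne_zero])
    obtain ⟨n₀, h₀⟩ := exists_cell_scale (d := d) (show 0 < min (1 / 4) (η / 8) by positivity)
    refine hR.prob_tuple_le (isoscelesSet d m) (n₀ := n₀) fun n hn => ?_
    have h1 := (h₀ n hn).trans (min_le_left _ _)
    exact mass_isoscelesSet_le hvol (h1.trans (by norm_num)) h1
      ((h₀ n hn).trans (min_le_right _ _))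
  filter_upwards [ae_all_iff.2 key] with ω hω x hx y hy z hz hxy hxz hyz heq
  obtain ⟨m, hm⟩ := exists_nat_ge (max (dist x 0) (max (dist y 0) (dist z 0)))
  refine hω m ⟨![x, y, z], ⟨?_, heq⟩, ?_, ?_⟩
  · have h1 := (le_max_left _ _).trans hm
    have h2 := (le_max_right _ _).trans hm
    intro i
    fin_cases i
    · exact h1
    · exact (le_max_left _ _).trans h2
    · exact (le_max_right _ _).trans h2
  · intro i j hij
    fin_cases i <;> fin_cases j <;> simp_all
  · intro i
    fin_cases i <;> simpa

lemma IsUnitPoissonProcess.ae_finite_inter (hR : IsUnitPoissonProcess P R) {B : Set (Space d)}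
    (hB : MeasurableSet B) (hv : volume B ≠ ∞) : ∀ᵐ ω ∂P, (R ω ∩ B).Finite := by
  have hmeas : ∀ n : ℕ, MeasurableSet {ω | (R ω ∩ B).encard = n} := by
    intro n
    have : {ω | (R ω ∩ B).encard = n} =
        (fun ω => ((R ω ∩ B).encard : ℝ≥0∞)) ⁻¹' {(n : ℝ≥0∞)} := by
      ext ω
      simp only [Set.mem_ofPred_eq, Set.mem_preimage, Set.mem_singleton_iff]
      rw [← ENat.toENNReal_coe, ENat.toENNReal_inj]
    rw [this]
    exact hR.measurable_count B hB (measurableSet_singleton _)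
  have hset : {ω | (R ω ∩ B).Finite} = ⋃ n : ℕ, {ω | (R ω ∩ B).encard = n} := by
    ext ω
    simp only [Set.mem_ofPred_eq, Set.mem_iUnion]
    rw [← Set.encard_lt_top_iff, lt_top_iff_ne_top, ENat.ne_top_iff_exists]
    simp [eq_comm]
  have hone : P {ω | (R ω ∩ B).Finite} = 1 := by
    rw [hset, measure_iUnion (fun i j hij => Set.disjoint_left.2 fun ω h1 h2 => hij ?_) hmeas]
    · rw [tsum_congr fun n => hR.count_law B hB hv n, ← measure_univ
        (μ := poissonMeasure (volume B).toNNReal), ← Set.iUnion_of_singleton ℕ, measure_iUnion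
        (fun i j hij => Set.disjoint_singleton.2 hij) (fun n => measurableSet_singleton n)]
    · have := h1.symm.trans h2
      exact_mod_cast this
  have hm : MeasurableSet {ω | (R ω ∩ B).Finite} := hset ▸ MeasurableSet.iUnion hmeas
  exact (prob_compl_eq_zero_iff hm).2 hone

lemma IsUnitPoissonProcess.ae_locFin (hR : IsUnitPoissonProcess P R) :
    ∀ᵐ ω ∂P, LocFin (R ω) :=
  ae_all_iff.2 fun _ =>
    hR.ae_finite_inter Metric.isClosed_closedBall.measurableSet measure_closedBall_lt_top.ne

lemma IsUnitPoissonProcess.ae_good (hd : 1 ≤ d) (hR : IsUnitPoissonProcess P R) :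
    ∀ᵐ ω ∂P, Good (R ω) := by
  have h2 : ∀ᵐ ω ∂P, ∀ a b : ℚ, Thin d a b → ∀ m : ℕ, ∃ k : ℕ,
      ¬ ∃ x ∈ pathSet d a b m k, Function.Injective x ∧ ∀ i, x i ∈ R ω := by
    simp only [ae_all_iff]
    exact fun a b hab m => hR.ae_no_path hab m
  filter_upwards [hR.ae_locFin, h2, hR.ae_noIsosceles hd] with ω h1 h2 h3
  exact ⟨h1, h3, wf_shorter_of_no_path hd h1 h2⟩

end Discretisation

/-! ### The measurable space of locally finite configurations -/

section Configurations

variable {d : ℕ}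

/-- The locally finite subsets of `ℝ^d`. -/
structure Config (d : ℕ) : Type where
  /-- The underlying set. -/
  points : Set (Space d)
  locFin : LocFin points

/-- The number of points of `U` in `B`. -/
noncomputable def cnt (U : Set (Space d)) (B : Set (Space d)) : ℝ≥0∞ := ((U ∩ B).encard : ℝ≥0∞)

/-- The Borel sets of finite volume. -/
abbrev FinBorel (d : ℕ) : Type := {B : Set (Space d) // MeasurableSet B ∧ volume B ≠ ∞}

/-- The family of all counts in Borel sets of finite volume. -/
noncomputable def counts (U : Config d) : FinBorel d → ℝ≥0∞ := fun B => cnt U.1 B.1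

noncomputable instance : MeasurableSpace (Config d) := MeasurableSpace.comap counts inferInstance

lemma measurable_counts : Measurable (counts : Config d → FinBorel d → ℝ≥0∞) :=
  comap_measurable _

lemma encard_iUnion_eq_tsum {α ι : Type*} [Countable ι] {s : ι → Set α}
    (hs : Pairwise fun i j => Disjoint (s i) (s j)) :
    ((⋃ i, s i).encard : ℝ≥0∞) = ∑' i, ((s i).encard : ℝ≥0∞) := by
  let _ : MeasurableSpace α := ⊤
  have h : ∀ t : Set α, (t.encard : ℝ≥0∞) = Measure.count t := fun t =>
    (Measure.count_apply MeasurableSpace.measurableSet_top).symm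
  simp only [h]
  exact measure_iUnion hs fun i => MeasurableSpace.measurableSet_top

lemma cnt_iUnion {ι : Type*} [Countable ι] (U : Set (Space d)) {B : ι → Set (Space d)}
    (hB : Pairwise fun i j => Disjoint (B i) (B j)) : cnt U (⋃ i, B i) = ∑' i, cnt U (B i) := by
  rw [cnt, Set.inter_iUnion, encard_iUnion_eq_tsum fun i j hij =>
    (hB hij).mono Set.inter_subset_right Set.inter_subset_right]
  rfl

lemma cnt_eq_tsum_cube (U B : Set (Space d)) (n : ℕ) : cnt U B = ∑' v, cnt U (B ∩ cube n v) := by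
  rw [← cnt_iUnion U fun v w hvw =>
    (disjoint_cube hvw).mono Set.inter_subset_right Set.inter_subset_right]
  congr 1
  ext x
  simp [mem_cube]

lemma measurable_cnt {B : Set (Space d)} (hB : MeasurableSet B) :
    Measurable fun U : Config d => cnt U.1 B := by
  simp only [cnt_eq_tsum_cube _ B 0]
  refine Measurable.tsum fun v => ?_
  have hv : volume (B ∩ cube 0 v) ≠ ∞ := ne_top_of_le_ne_top
    (by rw [volume_cube]; exact ENNReal.ofReal_ne_top) (measure_mono Set.inter_subset_right)
  exact (measurable_pi_apply
    (⟨B ∩ cube 0 v, hB.inter (measurableSet_cube 0 v), hv⟩ : FinBorel d)).comp measurable_counts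

lemma measurable_config_iff {Ω : Type*} [MeasurableSpace Ω] {f : Ω → Config d} :
    Measurable f ↔ ∀ B : Set (Space d), MeasurableSet B → Measurable fun ω => cnt (f ω).1 B := by
  refine ⟨fun h B hB => (measurable_cnt hB).comp h, fun h => ?_⟩
  exact measurable_comap_iff.2 (measurable_pi_lambda _ fun B => h B.1 B.2.1)

/-! ### Measurable enumeration of the points -/

lemma exists_isolating_cube {U : Set (Space d)} (hU : LocFin U) {x : Space d} (hx : x ∈ U) :
    ∃ n v, U ∩ cube n v = {x} := by
  have hfin := hU.finite_inter (B := Metric.closedBall x 1) Metric.isBounded_closedBall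
  have hsep : ∀ y : Space d, ∃ N, ∀ n ≥ N, y ≠ x → cell n y ≠ cell n x := by
    intro y
    by_cases hy : y = x
    · exact ⟨0, fun n _ h => (h hy).elim⟩
    · obtain ⟨N, hN⟩ := exists_cell_ne hy
      exact ⟨N, fun n hn _ => hN n hn⟩
  choose N hN using hsep
  obtain ⟨M, hM⟩ := (hfin.image N).bddAbove
  obtain ⟨n₀, h₀⟩ := exists_cell_scale (d := d) one_pos
  refine ⟨max M n₀, cell (max M n₀) x, Set.eq_singleton_iff_unique_mem.2 ⟨⟨hx, rfl⟩, ?_⟩⟩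
  rintro y ⟨hy, hyc⟩
  by_contra hne
  have hball : y ∈ Metric.closedBall x 1 :=
    (dist_le_of_cell_eq hyc).trans (h₀ _ (le_max_right _ _))
  exact hN y _ ((hM ⟨y, ⟨hy, hball⟩, rfl⟩).trans (le_max_left _ _)) hne hyc

/-- An enumeration of all dyadic cubes. -/
noncomputable def dyadic (j : ℕ) : Set (Space d) :=
  cube ((exists_surjective_nat (ℕ × (Fin d → ℤ))).choose j).1
    ((exists_surjective_nat (ℕ × (Fin d → ℤ))).choose j).2

lemma exists_dyadic_eq (n : ℕ) (v : Fin d → ℤ) : ∃ j, dyadic j = cube n v := by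
  obtain ⟨j, hj⟩ := (exists_surjective_nat (ℕ × (Fin d → ℤ))).choose_spec (n, v)
  exact ⟨j, by rw [dyadic, hj]⟩

lemma measurableSet_dyadic (j : ℕ) : MeasurableSet (dyadic j : Set (Space d)) :=
  measurableSet_cube _ _

lemma volume_dyadic_ne_top (j : ℕ) : volume (dyadic j : Set (Space d)) ≠ ∞ := by
  rw [dyadic, volume_cube]; exact ENNReal.ofReal_ne_top

/-- The `j`-th dyadic cube contains exactly one point of `U`. -/
def Single (U : Set (Space d)) (j : ℕ) : Prop := (U ∩ dyadic j).encard = 1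

open Classical in
/-- The point of `U` in the `j`-th dyadic cube, if there is exactly one. -/
noncomputable def pt (U : Set (Space d)) (j : ℕ) : Space d :=
  if h : Single U j then (Set.encard_eq_one.1 h).choose else 0

lemma Single.inter_eq {U : Set (Space d)} {j : ℕ} (h : Single U j) : U ∩ dyadic j = {pt U j} := by
  rw [pt, dif_pos h]
  exact (Set.encard_eq_one.1 h).choose_spec

lemma Single.pt_mem {U : Set (Space d)} {j : ℕ} (h : Single U j) : pt U j ∈ U :=
  (h.inter_eq ▸ Set.mem_singleton _ : pt U j ∈ U ∩ dyadic j).1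

lemma exists_single {U : Set (Space d)} (hU : LocFin U) {x : Space d} (hx : x ∈ U) :
    ∃ j, Single U j ∧ pt U j = x := by
  obtain ⟨n, v, h⟩ := exists_isolating_cube hU hx
  obtain ⟨j, hj⟩ := exists_dyadic_eq n v
  have hs : Single U j := by rw [Single, hj, h, Set.encard_singleton]
  refine ⟨j, hs, ?_⟩
  have := hs.inter_eq
  rw [hj, h] at this
  exact (Set.singleton_eq_singleton_iff.1 this).symm

lemma forall_mem_iff {U : Set (Space d)} (hU : LocFin U) {p : Space d → Prop} :
    (∀ x ∈ U, p x) ↔ ∀ j, Single U j → p (pt U j) := by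
  refine ⟨fun h j hj => h _ hj.pt_mem, fun h x hx => ?_⟩
  obtain ⟨j, hj, rfl⟩ := exists_single hU hx
  exact h j hj

lemma encard_eq_one_iff_cnt {U B : Set (Space d)} : (U ∩ B).encard = 1 ↔ cnt U B = 1 := by
  rw [cnt, ← ENat.toENNReal_one, ENat.toENNReal_inj]

lemma measurable_single (j : ℕ) : Measurable fun U : Config d => Single U.1 j := by
  simp only [Single, encard_eq_one_iff_cnt]
  exact measurableSet_setOfPred.1 (measurable_cnt (measurableSet_dyadic j) (measurableSet_singleton 1))

lemma measurable_pt (j : ℕ) : Measurable fun U : Config d => pt U.1 j := by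
  intro B hB
  have : (fun U : Config d => pt U.1 j) ⁻¹' B =
      {U : Config d | (Single U.1 j ∧ cnt U.1 (dyadic j ∩ B) = 1) ∨
        (¬ Single U.1 j ∧ (0 : Space d) ∈ B)} := by
    ext U
    simp only [Set.mem_preimage, Set.mem_ofPred_eq]
    by_cases h : Single U.1 j
    · simp only [h, true_and, not_true, false_and, or_false]
      rw [← encard_eq_one_iff_cnt, ← Set.inter_assoc, h.inter_eq]
      by_cases hm : pt U.1 j ∈ B
      · simp [hm, Set.inter_eq_left.2 (Set.singleton_subset_iff.2 hm)]
      · simp [hm, Set.singleton_inter_eq_empty.2 hm]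
    · simp [h, pt]
  rw [this, measurableSet_setOfPred]
  refine ((measurable_single j).and (measurableSet_setOfPred.1 ?_)).or
    ((measurable_single j).not.and measurable_const)
  exact measurable_cnt ((measurableSet_dyadic j).inter hB) (measurableSet_singleton 1)

lemma measurable_pt_eq (i j : ℕ) : Measurable fun U : Config d => pt U.1 i = pt U.1 j :=
  measurableSet_setOfPred.1 (measurableSet_eq_fun (measurable_pt i) (measurable_pt j))

lemma measurable_dist_lt (i j k l : ℕ) : Measurable fun U : Config d =>
    dist (pt U.1 i) (pt U.1 j) < dist (pt U.1 k) (pt U.1 l) :=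
  measurableSet_setOfPred.1 (measurableSet_lt ((measurable_pt i).dist (measurable_pt j))
    ((measurable_pt k).dist (measurable_pt l)))

/-- `Shorter` for a pair of enumerated points. -/
def ShorterIdx (U : Set (Space d)) (k l i j : ℕ) : Prop :=
  Single U k ∧ Single U l ∧ (pt U k = pt U i ∨ pt U k = pt U j) ∧ ¬ pt U k = pt U l ∧
    dist (pt U k) (pt U l) < dist (pt U i) (pt U j)

lemma measurable_shorterIdx (k l i j : ℕ) :
    Measurable fun U : Config d => ShorterIdx U.1 k l i j :=
  (measurable_single k).and <| (measurable_single l).and <|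
    ((measurable_pt_eq k i).or (measurable_pt_eq k j)).and <| (measurable_pt_eq k l).not.and <|
      measurable_dist_lt k l i j

lemma exists_shorterIdx {U : Set (Space d)} (hU : LocFin U) {f : Space d × Space d} {i j : ℕ}
    (h : Shorter U f (pt U i, pt U j)) : ∃ k l, ShorterIdx U k l i j ∧ (pt U k, pt U l) = f := by
  obtain ⟨x, y⟩ := f
  obtain ⟨h1, hx, hy, h2, h3⟩ := h
  obtain ⟨k, hk, rfl⟩ := exists_single hU hx
  obtain ⟨l, hl, rfl⟩ := exists_single hU hy
  exact ⟨k, l, ⟨hk, hl, h1, h2, h3⟩, rfl⟩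

lemma ShorterIdx.shorter {U : Set (Space d)} {k l i j : ℕ} (h : ShorterIdx U k l i j) :
    Shorter U (pt U k, pt U l) (pt U i, pt U j) :=
  ⟨h.2.2.1, h.1.pt_mem, h.2.1.pt_mem, h.2.2.2.1, h.2.2.2.2⟩

lemma measurable_stage (n : ℕ) :
    (∀ i j, Measurable fun U : Config d => (stage U.1 n).1 (pt U.1 i, pt U.1 j)) ∧
      ∀ i j, Measurable fun U : Config d => (stage U.1 n).2 (pt U.1 i, pt U.1 j) := by
  induction n with
  | zero => exact ⟨fun _ _ => measurable_const, fun _ _ => measurable_const⟩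
  | succ n ih =>
    constructor
    · intro i j
      have : (fun U : Config d => (stage U.1 (n + 1)).1 (pt U.1 i, pt U.1 j)) = fun U =>
          ∀ k l, ShorterIdx U.1 k l i j → (stage U.1 n).2 (pt U.1 k, pt U.1 l) := by
        funext U
        refine propext ⟨fun h k l hkl => h _ hkl.shorter, fun h f hf => ?_⟩
        obtain ⟨k, l, hkl, rfl⟩ := exists_shorterIdx U.2 hf
        exact h k l hkl
      rw [this]
      exact Measurable.forall fun k => Measurable.forall fun l =>
        (measurable_shorterIdx k l i j).imp (ih.2 k l)
    · intro i j
      have : (fun U : Config d => (stage U.1 (n + 1)).2 (pt U.1 i, pt U.1 j)) = fun U =>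
          ∃ k l, ShorterIdx U.1 k l i j ∧ (stage U.1 n).1 (pt U.1 k, pt U.1 l) := by
        funext U
        refine propext ⟨fun ⟨f, hf, h⟩ => ?_, fun ⟨k, l, hkl, h⟩ => ⟨_, hkl.shorter, h⟩⟩
        obtain ⟨k, l, hkl, rfl⟩ := exists_shorterIdx U.2 hf
        exact ⟨k, l, hkl, h⟩
      rw [this]
      exact Measurable.exists fun k => Measurable.exists fun l =>
        (measurable_shorterIdx k l i j).and (ih.1 k l)

/-- The `i`-th and the `j`-th enumerated points are joined by an accepted edge. -/
def AdjIdx (U : Set (Space d)) (i j : ℕ) : Prop :=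
  Single U j ∧ ¬ pt U i = pt U j ∧ Accepted U (pt U i, pt U j)

lemma measurable_adjIdx (i j : ℕ) : Measurable fun U : Config d => AdjIdx U.1 i j :=
  (measurable_single j).and <| (measurable_pt_eq i j).not.and <|
    Measurable.exists fun n => (measurable_stage n).1 i j

open Classical in
/-- The distance from the `i`-th enumerated point to its partner. -/
noncomputable def pdIdx (U : Set (Space d)) (i : ℕ) : ℝ≥0∞ :=
  ⨅ j, if AdjIdx U i j then edist (pt U i) (pt U j) else ∞

lemma measurable_pdIdx (i : ℕ) : Measurable fun U : Config d => pdIdx U.1 i :=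
  Measurable.iInf fun j => Measurable.ite (measurableSet_setOfPred.2 (measurable_adjIdx i j))
    ((measurable_pt i).edist (measurable_pt j)) measurable_const

lemma pdIdx_eq {U : Set (Space d)} (hU : LocFin U) {i : ℕ} (hi : Single U i) :
    pdIdx U i = pd U (pt U i) := by
  refine le_antisymm (le_iInf₂ fun y hy => ?_) (le_iInf fun j => ?_)
  · obtain ⟨j, hj, rfl⟩ := exists_single hU hy.2.1
    refine (iInf_le _ j).trans_eq (if_pos ⟨hj, hy.2.2.1, hy.2.2.2⟩)
  · split_ifs with h
    · exact iInf₂_le (f := fun y (_ : (matchGraph U).Adj (pt U i) y) => edist (pt U i) y) (pt U j)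
        ⟨hi.pt_mem, h.1.pt_mem, h.2.1, h.2.2⟩
    · exact le_top

/-- The index `j` is the first one for its point. -/
def First (U : Set (Space d)) (j : ℕ) : Prop :=
  Single U j ∧ ∀ i < j, Single U i → ¬ pt U i = pt U j

lemma measurable_first (j : ℕ) : Measurable fun U : Config d => First U.1 j :=
  (measurable_single j).and <| Measurable.forall fun i => Measurable.imp measurable_const <|
    (measurable_single i).imp (measurable_pt_eq i j).not

lemma exists_first {U : Set (Space d)} (hU : LocFin U) {x : Space d} (hx : x ∈ U) :
    ∃ j, First U j ∧ pt U j = x := by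
  classical
  have h := exists_single hU hx
  refine ⟨Nat.find h, ⟨(Nat.find_spec h).1, fun i hi hs he => Nat.find_min h hi ⟨hs, ?_⟩⟩,
    (Nat.find_spec h).2⟩
  rw [he, (Nat.find_spec h).2]

lemma First.inj {U : Set (Space d)} {i j : ℕ} (hi : First U i) (hj : First U j)
    (h : pt U i = pt U j) : i = j := by
  by_contra hne
  rcases Nat.lt_or_gt_of_ne hne with hlt | hlt
  · exact hj.2 i hlt hi.1 h
  · exact hi.2 j hlt hj.1 h.symm

/-- The number of points of `U` in `B` whose distance to the partner belongs to `T`. -/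
noncomputable def pdCount (U : Set (Space d)) (T : Set ℝ≥0∞) (B : Set (Space d)) : ℝ≥0∞ :=
  ({x | x ∈ U ∩ B ∧ pd U x ∈ T}.encard : ℝ≥0∞)

/-- The configurations in which the index `j` is the first one for a point in `B`, whose distance
to the partner belongs to `T`. -/
def idxEvent (T : Set ℝ≥0∞) (B : Set (Space d)) (j : ℕ) : Set (Config d) :=
  {U | First U.1 j ∧ pt U.1 j ∈ B ∧ pdIdx U.1 j ∈ T}

lemma measurableSet_idxEvent {T : Set ℝ≥0∞} {B : Set (Space d)} (hT : MeasurableSet T)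
    (hB : MeasurableSet B) (j : ℕ) : MeasurableSet (idxEvent T B j) :=
  (measurableSet_setOfPred.2 (measurable_first j)).inter
    ((measurable_pt j hB).inter (measurable_pdIdx j hT))

lemma pdCount_eq_tsum (U : Config d) (T : Set ℝ≥0∞) (B : Set (Space d)) :
    pdCount U.1 T B = ∑' j, (idxEvent T B j).indicator (fun _ => (1 : ℝ≥0∞)) U := by
  have hset : {x | x ∈ U.1 ∩ B ∧ pd U.1 x ∈ T} =
      ⋃ j, {x | x = pt U.1 j ∧ U ∈ idxEvent T B j} := by
    ext x
    simp only [Set.mem_ofPred_eq, Set.mem_iUnion, idxEvent]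
    constructor
    · rintro ⟨⟨hx, hB⟩, hT⟩
      obtain ⟨j, hj, rfl⟩ := exists_first U.2 hx
      exact ⟨j, rfl, hj, hB, by rwa [pdIdx_eq U.2 hj.1]⟩
    · rintro ⟨j, rfl, hj, hB, hT⟩
      exact ⟨⟨hj.1.pt_mem, hB⟩, by rwa [← pdIdx_eq U.2 hj.1]⟩
  rw [pdCount, hset, encard_iUnion_eq_tsum]
  · refine tsum_congr fun j => ?_
    by_cases h : U ∈ idxEvent T B j
    · simp [h]
    · simp [h]
  · intro i j hij
    refine Set.disjoint_left.2 ?_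
    rintro x ⟨hx, hi⟩ ⟨hx', hj⟩
    exact hij (hi.1.inj hj.1 (hx.symm.trans hx'))

lemma measurable_pdCount {T : Set ℝ≥0∞} {B : Set (Space d)} (hT : MeasurableSet T)
    (hB : MeasurableSet B) : Measurable fun U : Config d => pdCount U.1 T B := by
  simp only [pdCount_eq_tsum]
  exact Measurable.tsum fun j =>
    measurable_const.indicator (measurableSet_idxEvent hT hB j)

lemma pdCount_univ (U B : Set (Space d)) : pdCount U Set.univ B = cnt U B := by
  simp only [pdCount, cnt, Set.mem_univ, and_true]
  rfl

lemma pdCount_translate (U : Set (Space d)) (T : Set ℝ≥0∞) (B : Set (Space d)) (z : Space d) :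
    pdCount ((· + z) '' U) T ((· + z) '' B) = pdCount U T B := by
  have hmem : ∀ (V : Set (Space d)) (x : Space d), x + z ∈ (· + z) '' V ↔ x ∈ V := fun V x =>
    (add_left_injective z).mem_set_image
  have : {x | x ∈ (· + z) '' U ∩ (· + z) '' B ∧ pd ((· + z) '' U) x ∈ T} =
      (· + z) '' {x | x ∈ U ∩ B ∧ pd U x ∈ T} := by
    ext x
    obtain ⟨y, rfl⟩ : ∃ y, y + z = x := ⟨x - z, sub_add_cancel x z⟩
    rw [hmem]
    simp only [Set.mem_ofPred_eq, Set.mem_inter_iff, hmem, pd_translate]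
  rw [pdCount, this, (add_left_injective z).encard_image, pdCount]

end Configurations

/-! ### The law of a Poisson process -/

section Law

variable {d : ℕ}

/-- The points that belong to exactly those sets `B i` with `i ∈ s`. -/
def atom {ι : Type*} (B : ι → Set (Space d)) (s : Finset ι) : Set (Space d) :=
  {x | ∀ i, x ∈ B i ↔ i ∈ s}

lemma measurableSet_atom {ι : Type*} [Countable ι] {B : ι → Set (Space d)}
    (hB : ∀ i, MeasurableSet (B i)) (s : Finset ι) : MeasurableSet (atom B s) :=
  measurableSet_setOfPred.2 <| Measurable.forall fun i =>
    (measurableSet_setOfPred.1 (hB i)).iff measurable_const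

lemma disjoint_atom {ι : Type*} {B : ι → Set (Space d)} {s t : Finset ι} (h : s ≠ t) :
    Disjoint (atom B s) (atom B t) :=
  Set.disjoint_left.2 fun _ hs ht => h (Finset.ext fun i => (hs i).symm.trans (ht i))

lemma atom_subset {ι : Type*} {B : ι → Set (Space d)} {s : Finset ι} {i : ι} (hi : i ∈ s) :
    atom B s ⊆ B i := fun _ hx => (hx i).2 hi

open Classical in
lemma cnt_eq_sum_atom {ι : Type*} [Fintype ι] (B : ι → Set (Space d)) (U : Set (Space d)) (i : ι) :
    cnt U (B i) =
      ∑ s : {s : Finset ι // s.Nonempty}, if i ∈ s.1 then cnt U (atom B s.1) else 0 := by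
  have h : B i = ⋃ s : {s : Finset ι // s.Nonempty}, if i ∈ s.1 then atom B s.1 else ∅ := by
    ext x
    simp only [Set.mem_iUnion]
    constructor
    · intro hx
      have hi : i ∈ Finset.univ.filter fun j => x ∈ B j := by simpa using hx
      refine ⟨⟨Finset.univ.filter fun j => x ∈ B j, i, hi⟩, ?_⟩
      rw [if_pos hi]
      exact fun j => by simp
    · rintro ⟨s, hs⟩
      split_ifs at hs with his
      · exact atom_subset his hs
      · exact hs.elim
  conv_lhs => rw [h]
  rw [cnt_iUnion, tsum_fintype]
  · refine Finset.sum_congr rfl fun s _ => ?_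
    split_ifs
    · rfl
    · simp [cnt]
  · intro s t hst
    split_ifs
    · exact disjoint_atom fun h => hst (Subtype.ext h)
    all_goals simp

variable {Ω : Type*} [MeasurableSpace Ω] {P : Measure Ω}
  {R : Ω → Set (Space d)}

lemma IsUnitPoissonProcess.iIndepFun_cnt (hR : IsUnitPoissonProcess P R) {ι : Type*} [Fintype ι]
    {B : ι → Set (Space d)} (hB : ∀ i, MeasurableSet (B i))
    (hd : Pairwise fun i j => Disjoint (B i) (B j)) :
    iIndepFun (fun i ω => cnt (R ω) (B i)) P := by
  let e := Fintype.equivFin ι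
  have h := hR.indep_count (Fintype.card ι) (fun k => B (e.symm k)) (fun k => hB _)
    fun i j hij => hd (e.symm.injective.ne hij)
  have h2 := h.precomp e.injective
  simp only [Equiv.symm_apply_apply] at h2
  exact h2

lemma ext_of_natCast {μ ν : Measure ℝ≥0∞} (h : ∀ n : ℕ, μ {(n : ℝ≥0∞)} = ν {(n : ℝ≥0∞)})
    (hμ : μ (Set.range fun n : ℕ => (n : ℝ≥0∞))ᶜ = 0)
    (hν : ν (Set.range fun n : ℕ => (n : ℝ≥0∞))ᶜ = 0) : μ = ν := by
  have key : ∀ ρ : Measure ℝ≥0∞, ρ (Set.range fun n : ℕ => (n : ℝ≥0∞))ᶜ = 0 → ∀ T : Set ℝ≥0∞,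
      MeasurableSet T → ρ T = ∑' n : ℕ, T.indicator (fun x => ρ {x}) (n : ℝ≥0∞) := by
    intro ρ hρ T hT
    rw [← measure_inter_conull hρ, ← Set.iUnion_singleton_eq_range, Set.inter_iUnion,
      measure_iUnion]
    · refine tsum_congr fun n => ?_
      by_cases hn : (n : ℝ≥0∞) ∈ T
      · rw [Set.indicator_of_mem hn, Set.inter_eq_right.2 (Set.singleton_subset_iff.2 hn)]
      · rw [Set.indicator_of_notMem hn, Set.inter_singleton_eq_empty.2 hn, measure_empty]
    · intro i j hij
      exact (Set.disjoint_singleton.2 (Nat.cast_injective.ne hij)).mono Set.inter_subset_right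
        Set.inter_subset_right
    · exact fun n => hT.inter (measurableSet_singleton _)
  ext T hT
  rw [key μ hμ T hT, key ν hν T hT]
  refine tsum_congr fun n => ?_
  by_cases hn : (n : ℝ≥0∞) ∈ T
  · rw [Set.indicator_of_mem hn, Set.indicator_of_mem hn, h]
  · rw [Set.indicator_of_notMem hn, Set.indicator_of_notMem hn]

lemma IsUnitPoissonProcess.measurable_cnt (hR : IsUnitPoissonProcess P R) {B : Set (Space d)}
    (hB : MeasurableSet B) : Measurable fun ω => cnt (R ω) B := hR.measurable_count B hB

lemma cnt_eq_natCast_iff {U B : Set (Space d)} {n : ℕ} : cnt U B = n ↔ (U ∩ B).encard = n := by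
  rw [cnt, ← ENat.toENNReal_coe, ENat.toENNReal_inj]

lemma IsUnitPoissonProcess.map_cnt [IsProbabilityMeasure P]
    (hR : IsUnitPoissonProcess P R) {B : Set (Space d)}
    (hB : MeasurableSet B) (hv : volume B ≠ ∞) :
    P.map (fun ω => cnt (R ω) B) =
      (poissonMeasure (volume B).toNNReal).map fun n : ℕ => (n : ℝ≥0∞) := by
  have hcast : Measurable fun n : ℕ => (n : ℝ≥0∞) := measurable_of_countable _
  have hrange : MeasurableSet (Set.range fun n : ℕ => (n : ℝ≥0∞))ᶜ :=
    (Set.countable_range _).measurableSet.compl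
  refine ext_of_natCast (fun n => ?_) ?_ ?_
  · rw [Measure.map_apply (hR.measurable_cnt hB) (measurableSet_singleton _),
      Measure.map_apply hcast (measurableSet_singleton _)]
    have h1 : (fun ω => cnt (R ω) B) ⁻¹' {(n : ℝ≥0∞)} = {ω | (R ω ∩ B).encard = n} := by
      ext ω; exact cnt_eq_natCast_iff
    have h2 : (fun n : ℕ => (n : ℝ≥0∞)) ⁻¹' {(n : ℝ≥0∞)} = {n} := by
      ext k; simp
    rw [h1, h2, hR.count_law B hB hv n]
  · rw [Measure.map_apply (hR.measurable_cnt hB) hrange]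
    refine measure_mono_null ?_ (hR.ae_finite_inter hB hv)
    intro ω hω hfin
    refine hω ⟨(R ω ∩ B).ncard, ?_⟩
    exact (cnt_eq_natCast_iff.2 hfin.cast_ncard_eq.symm).symm
  · rw [Measure.map_apply hcast hrange]
    convert measure_empty (μ := poissonMeasure (volume B).toNNReal)
    ext n; simp

/-- The joint law of the numbers of points of a Poisson process in the sets `B i`. -/
noncomputable def jointLaw {ι : Type*} [Fintype ι] (B : ι → Set (Space d)) :
    Measure (ι → ℝ≥0∞) := by
  classical
  exact (Measure.pi fun s : {s : Finset ι // s.Nonempty} =>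
    (poissonMeasure (volume (atom B s.1)).toNNReal).map fun n : ℕ => (n : ℝ≥0∞)).map
      fun c i => ∑ s, if i ∈ s.1 then c s else 0

lemma IsUnitPoissonProcess.map_cnt_family [IsProbabilityMeasure P]
    (hR : IsUnitPoissonProcess P R) {ι : Type*} [Fintype ι]
    {B : ι → Set (Space d)} (hB : ∀ i, MeasurableSet (B i)) (hv : ∀ i, volume (B i) ≠ ∞) :
    P.map (fun ω i => cnt (R ω) (B i)) = jointLaw B := by
  classical
  have hind := hR.iIndepFun_cnt (B := fun s : {s : Finset ι // s.Nonempty} => atom B s.1)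
    (fun s => measurableSet_atom hB s.1) fun s t hst => disjoint_atom fun h => hst (Subtype.ext h)
  have hm : ∀ s : {s : Finset ι // s.Nonempty}, Measurable fun ω => cnt (R ω) (atom B s.1) :=
    fun s => hR.measurable_cnt (measurableSet_atom hB s.1)
  rw [iIndepFun_iff_map_fun_eq_pi_map fun s => (hm s).aemeasurable] at hind
  have hlaw : ∀ s : {s : Finset ι // s.Nonempty}, P.map (fun ω => cnt (R ω) (atom B s.1)) =
      (poissonMeasure (volume (atom B s.1)).toNNReal).map fun n : ℕ => (n : ℝ≥0∞) := fun s => by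
    obtain ⟨i, hi⟩ := s.2
    exact hR.map_cnt (measurableSet_atom hB s.1)
      (ne_top_of_le_ne_top (hv i) (measure_mono (atom_subset hi)))
  simp only [hlaw] at hind
  have hf : Measurable fun (c : {s : Finset ι // s.Nonempty} → ℝ≥0∞) (i : ι) =>
      ∑ s, if i ∈ s.1 then c s else 0 := by
    refine measurable_pi_lambda _ fun i => Finset.measurable_sum _ fun s _ => ?_
    split_ifs
    · exact measurable_pi_apply s
    · exact measurable_const
  rw [jointLaw, ← hind, Measure.map_map hf (measurable_pi_lambda _ hm)]
  congr 1
  funext ω i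
  exact cnt_eq_sum_atom B (R ω) i

variable {S : Ω → Config d}

lemma IsUnitPoissonProcess.measurable_config (hS : IsUnitPoissonProcess P fun ω => (S ω).1) :
    Measurable S :=
  measurable_config_iff.2 fun _ hB => hS.measurable_cnt hB

lemma IsUnitPoissonProcess.map_counts [IsProbabilityMeasure P]
    (hS : IsUnitPoissonProcess P fun ω => (S ω).1)
    (J : Finset (FinBorel d)) :
    (P.map (counts ∘ S)).map J.restrict = jointLaw fun B : J => B.1.1 := by
  rw [Measure.map_map (Finset.measurable_restrict J) (measurable_counts.comp hS.measurable_config)]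
  exact hS.map_cnt_family (fun B => B.1.2.1) fun B => B.1.2.2

lemma IsUnitPoissonProcess.map_eq [IsProbabilityMeasure P] {Ω' : Type*} [MeasurableSpace Ω'] {P' : Measure Ω'}
    [IsProbabilityMeasure P'] {S' : Ω' → Config d}
    (hS : IsUnitPoissonProcess P fun ω => (S ω).1)
    (hS' : IsUnitPoissonProcess P' fun ω => (S' ω).1) : P.map S = P'.map S' := by
  have hm := measurable_counts.comp hS.measurable_config
  have hm' := measurable_counts.comp hS'.measurable_config
  have := Measure.isProbabilityMeasure_map hm.aemeasurable (μ := P)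
  have hfin : ∀ J : Finset (FinBorel d), IsFiniteMeasure (jointLaw fun B : J => B.1.1) :=
    fun J => by
      rw [← hS.map_counts J]
      infer_instance
  have heq : P.map (counts ∘ S) = P'.map (counts ∘ S') :=
    IsProjectiveLimit.unique (P := fun J : Finset (FinBorel d) => jointLaw fun B : J => B.1.1)
      (fun J => hS.map_counts J) (fun J => hS'.map_counts J)
  ext T hT
  obtain ⟨T', hT', rfl⟩ := hT
  rw [Measure.map_apply hS.measurable_config (measurable_counts hT'),
    Measure.map_apply hS'.measurable_config (measurable_counts hT'), ← Set.preimage_comp,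
    ← Set.preimage_comp, ← Measure.map_apply hm hT', ← Measure.map_apply hm' hT', heq]

/-! ### Translations -/

lemma LocFin.translate {U : Set (Space d)} (hU : LocFin U) (z : Space d) :
    LocFin ((· + z) '' U) := by
  intro n
  have : (· + z) '' U ∩ Metric.closedBall 0 n ⊆
      (· + z) '' (U ∩ (· + z) ⁻¹' Metric.closedBall 0 n) := by
    rintro _ ⟨⟨x, hx, rfl⟩, h⟩
    exact ⟨x, ⟨hx, h⟩, rfl⟩
  refine ((hU.finite_inter ?_).image _).subset this
  refine (Metric.isBounded_closedBall (x := (0 : Space d)) (r := n + ‖z‖)).subset ?_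
  intro x hx
  simp only [Set.mem_preimage, mem_closedBall_zero_iff] at hx ⊢
  have := norm_sub_le (x + z) z
  rw [add_sub_cancel_right] at this
  linarith

/-- The translation of a configuration. -/
def Config.translate (z : Space d) (U : Config d) : Config d := ⟨(· + z) '' U.1, U.2.translate z⟩

lemma encard_translate_inter (U B : Set (Space d)) (z : Space d) :
    ((· + z) '' U ∩ B).encard = (U ∩ (· + z) ⁻¹' B).encard := by
  rw [← Set.image_inter_preimage, (add_left_injective z).encard_image]

lemma IsUnitPoissonProcess.translate (hR : IsUnitPoissonProcess P R) (z : Space d) :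
    IsUnitPoissonProcess P fun ω => (· + z) '' R ω := by
  have hm : Measurable fun x : Space d => x + z := measurable_add_const z
  have hvol : ∀ B : Set (Space d), volume ((· + z) ⁻¹' B) = volume B := fun B =>
    measure_preimage_add_right volume z B
  refine ⟨fun B hB => ?_, fun B hB hv n => ?_, fun k B hB hd => ?_⟩
  · simp only [encard_translate_inter]
    exact hR.measurable_count _ (hm hB)
  · simp only [encard_translate_inter]
    rw [hR.count_law _ (hm hB) (by rwa [hvol]), hvol]
  · simp only [encard_translate_inter]
    exact hR.indep_count k _ (fun i => hm (hB i)) fun i j hij => (hd hij).preimage _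

/-- The point of `ℝ^d` with integer coordinates `v`. -/
noncomputable def latticePoint (v : Fin d → ℤ) : Space d := WithLp.toLp 2 fun i => (v i : ℝ)

lemma cube_eq_image (v : Fin d → ℤ) :
    cube 0 v = (· + latticePoint v) '' (unitCube d) := by
  ext x
  rw [Set.image_add_right, Set.mem_preimage, unitCube_eq_cube, mem_cube, mem_cube]
  simp only [funext_iff, cell, pow_zero, one_mul, Pi.zero_apply]
  refine forall_congr' fun i => ?_
  have : (x + -latticePoint v) i = x i - v i := by simp [latticePoint, sub_eq_add_neg]
  rw [this, Int.floor_sub_intCast, sub_eq_zero]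

lemma IsUnitPoissonProcess.lintegral_pdCount_cube [IsProbabilityMeasure P]
    (hS : IsUnitPoissonProcess P fun ω => (S ω).1) {T : Set ℝ≥0∞} (hT : MeasurableSet T)
    (v : Fin d → ℤ) :
    ∫⁻ ω, pdCount (S ω).1 T (cube 0 v) ∂P = ∫⁻ ω, pdCount (S ω).1 T (unitCube d) ∂P := by
  have hS' : IsUnitPoissonProcess P fun ω => ((S ω).translate (latticePoint v)).1 :=
    hS.translate (latticePoint v)
  have hmeas := measurable_pdCount hT (measurableSet_cube 0 v)
  rw [← lintegral_map (f := fun U : Config d => pdCount U.1 T (cube 0 v)) hmeas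
    hS.measurable_config, hS.map_eq hS', lintegral_map hmeas hS'.measurable_config]
  simp only [Config.translate, cube_eq_image, pdCount_translate]

/-! ### Independence of the configuration outside of a set -/

/-- The part of a configuration outside of `D`. -/
def Config.sdiff (D : Set (Space d)) (U : Config d) : Config d :=
  ⟨U.1 \ D, U.2.mono Set.sdiff_subset⟩

lemma cnt_sdiff (U D B : Set (Space d)) : cnt (U \ D) B = cnt U (B \ D) := by
  rw [cnt, cnt]
  congr 2
  ext x
  simp only [Set.mem_inter_iff, Set.mem_sdiff]
  tauto

lemma measurable_config_sdiff {D : Set (Space d)} (hD : MeasurableSet D) :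
    Measurable (Config.sdiff D) :=
  measurable_config_iff.2 fun B hB => by
    simp only [Config.sdiff, cnt_sdiff]
    exact measurable_cnt (hB.diff hD)

lemma IsUnitPoissonProcess.indepFun_sdiff [IsProbabilityMeasure P]
    (hS : IsUnitPoissonProcess P fun ω => (S ω).1)
    {D : Set (Space d)} (hD : MeasurableSet D) {E : Bool → Set (Space d)}
    (hE : ∀ j, MeasurableSet (E j)) (hED : ∀ j, E j ⊆ D)
    (hdisj : Pairwise fun i j => Disjoint (E i) (E j)) :
    IndepFun (fun ω => counts ((S ω).sdiff D)) (fun ω j => cnt (S ω).1 (E j)) P := by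
  classical
  have hX : ∀ B : FinBorel d, Measurable fun ω => counts ((S ω).sdiff D) B := fun B =>
    (measurable_pi_apply B).comp
      (measurable_counts.comp ((measurable_config_sdiff hD).comp hS.measurable_config))
  have hY : ∀ j, Measurable fun ω => cnt (S ω).1 (E j) := fun j => hS.measurable_cnt (hE j)
  refine IndepFun.process_indepFun_process (X := fun (B : FinBorel d) ω => counts ((S ω).sdiff D) B)
    (Y := fun j ω => cnt (S ω).1 (E j)) hX hY fun I J => ?_
  set B : I → Set (Space d) := fun i => i.1.1 \ D with hBdef
  have hB : ∀ i, MeasurableSet (B i) := fun i => i.1.2.1.diff hD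
  let F : {s : Finset I // s.Nonempty} ⊕ Bool → Set (Space d) :=
    Sum.elim (fun s => atom B s.1) E
  have hF : ∀ k, MeasurableSet (F k) := by
    rintro (s | j)
    · exact measurableSet_atom hB s.1
    · exact hE j
  have hout : ∀ (s : {s : Finset I // s.Nonempty}) j, Disjoint (atom B s.1) (E j) := by
    intro s j
    obtain ⟨i, hi⟩ := s.2
    exact Set.disjoint_left.2 fun x hx hj => (atom_subset hi hx).2 (hED j hj)
  have hFd : Pairwise fun k l => Disjoint (F k) (F l) := by
    rintro (s | i) (t | j) hkl
    · exact disjoint_atom fun h => hkl (by rw [Subtype.ext h])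
    · exact hout s j
    · exact (hout t i).symm
    · exact hdisj fun h => hkl (by rw [h])
  have hind := hS.iIndepFun_cnt hF hFd
  have h2 := hind.indepFun_finset (Finset.univ.image Sum.inl) (Finset.univ.image Sum.inr)
    (by
      rw [Finset.disjoint_left]
      simp only [Finset.mem_image, Finset.mem_univ, true_and]
      rintro _ ⟨s, rfl⟩ ⟨j, hj⟩
      cases hj) fun k => hS.measurable_cnt (hF k)
  have h3 := h2.comp
    (φ := fun c (i : I) => ∑ s : {s : Finset I // s.Nonempty},
      if i ∈ s.1 then c ⟨Sum.inl s, Finset.mem_image_of_mem _ (Finset.mem_univ s)⟩ else 0)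
    (ψ := fun c (j : J) => c ⟨Sum.inr j.1, Finset.mem_image_of_mem _ (Finset.mem_univ j.1)⟩)
    (measurable_pi_lambda _ fun i => Finset.measurable_sum _ fun s _ => by
      split_ifs
      · exact measurable_pi_apply _
      · exact measurable_const)
    (measurable_pi_lambda _ fun j => measurable_pi_apply _)
  convert h3 using 1
  · funext ω i
    change cnt ((S ω).1 \ D) i.1.1 = ∑ s : {s : Finset I // s.Nonempty},
      if i ∈ s.1 then cnt (S ω).1 (atom B s.1) else 0
    rw [cnt_sdiff]
    convert cnt_eq_sum_atom B (S ω).1 i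
  · rfl

lemma IsUnitPoissonProcess.prob_resample_ne_zero [IsProbabilityMeasure P]
    (hS : IsUnitPoissonProcess P fun ω => (S ω).1)
    {D Q : Set (Space d)} (hD : MeasurableSet D) (hDv : volume D ≠ ∞) (hQ : MeasurableSet Q)
    (hQD : Q ⊆ D) (hQv : volume Q ≠ 0) {L : Set (Config d)} (hL : MeasurableSet L)
    (h : P {ω | (S ω).sdiff D ∈ L} ≠ 0) :
    P {ω | (S ω).sdiff D ∈ L ∧ cnt (S ω).1 Q = 1 ∧ cnt (S ω).1 (D \ Q) = 0} ≠ 0 := by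
  let E : Bool → Set (Space d) := fun b => if b then Q else D \ Q
  have hE : ∀ j, MeasurableSet (E j) := by
    rintro (_ | _)
    · exact hD.diff hQ
    · exact hQ
  have hdisj : Pairwise fun i j => Disjoint (E i) (E j) := by
    rintro (_ | _) (_ | _) hij
    · exact (hij rfl).elim
    · exact Set.disjoint_sdiff_left
    · exact Set.disjoint_sdiff_right
    · exact (hij rfl).elim
  have hED : ∀ j, E j ⊆ D := by
    rintro (_ | _)
    · exact Set.sdiff_subset
    · exact hQD
  obtain ⟨L', hL', rfl⟩ := hL
  have hind := hS.indepFun_sdiff hD hE hED hdisj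
  have hpi : MeasurableSet {c : Bool → ℝ≥0∞ | c true = 1 ∧ c false = 0} :=
    (measurable_pi_apply true (measurableSet_singleton 1)).inter
      (measurable_pi_apply false (measurableSet_singleton 0))
  have h1 := hind.measure_inter_preimage_eq_mul L' _ hL' hpi
  have hset : {ω | (S ω).sdiff D ∈ counts ⁻¹' L' ∧ cnt (S ω).1 Q = 1 ∧ cnt (S ω).1 (D \ Q) = 0} =
      (fun ω => counts ((S ω).sdiff D)) ⁻¹' L' ∩
        (fun ω j => cnt (S ω).1 (E j)) ⁻¹' {c : Bool → ℝ≥0∞ | c true = 1 ∧ c false = 0} := rfl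
  rw [hset, h1]
  refine mul_ne_zero h ?_
  have hbool := (iIndepFun_iff_measure_inter_preimage_eq_mul.1 (hS.iIndepFun_cnt hE hdisj))
    Finset.univ (sets := fun b => if b then {1} else {0}) (by
      rintro (_ | _) _
      · exact measurableSet_singleton 0
      · exact measurableSet_singleton 1)
  have hset2 : (fun ω j => cnt (S ω).1 (E j)) ⁻¹' {c : Bool → ℝ≥0∞ | c true = 1 ∧ c false = 0} =
      ⋂ b ∈ Finset.univ, (fun ω => cnt (S ω).1 (E b)) ⁻¹' (if b then {1} else {0}) := by
    ext ω
    simp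
    tauto
  rw [hset2, hbool, Fintype.prod_bool]
  have hlaw : ∀ B : Set (Space d), MeasurableSet B → volume B ≠ ∞ → ∀ n : ℕ,
      P ((fun ω => cnt (S ω).1 B) ⁻¹' {(n : ℝ≥0∞)}) =
        poissonMeasure (volume B).toNNReal {n} := by
    intro B hB hv n
    rw [← hS.count_law B hB hv n]
    congr 1
    ext ω
    exact cnt_eq_natCast_iff
  have hQfin : volume Q ≠ ∞ := ne_top_of_le_ne_top hDv (measure_mono hQD)
  have hDfin : volume (D \ Q) ≠ ∞ := ne_top_of_le_ne_top hDv (measure_mono Set.sdiff_subset)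
  refine mul_ne_zero ?_ ?_
  · have := hlaw Q hQ hQfin 1
    rw [Nat.cast_one] at this
    simp only [if_true, E, this, poissonMeasure_singleton]
    have := ENNReal.toReal_pos hQv hQfin
    simp only [ne_eq, ENNReal.ofReal_eq_zero, not_le]
    have h0 : (0 : ℝ) < (volume Q).toNNReal := this
    positivity
  · have := hlaw (D \ Q) (hD.diff hQ) hDfin 0
    rw [Nat.cast_zero] at this
    simp only [Bool.false_eq_true, if_false, E, this, poissonMeasure_singleton]
    simp only [ne_eq, ENNReal.ofReal_eq_zero, not_le]
    simp [Real.exp_pos]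

end Law

/-! ### The typical distance -/

section Typical

variable {d : ℕ} {Ω : Type*} [MeasurableSpace Ω] {P : Measure Ω}
  {S : Ω → Config d}

/-- The measure `T ↦ E #{x ∈ S ∩ [0,1)^d : pd x ∈ T}`. -/
noncomputable def distLaw (P : Measure Ω) (S : Ω → Config d) : Measure ℝ≥0∞ :=
  Measure.sum fun j => (P.restrict (S ⁻¹' idxEvent Set.univ (unitCube d) j)).map
    fun ω => pdIdx (S ω).1 j

lemma distLaw_apply (hS : Measurable S) {T : Set ℝ≥0∞} (hT : MeasurableSet T) :
    distLaw P S T = ∫⁻ ω, pdCount (S ω).1 T (unitCube d) ∂P := by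
  have hm : ∀ j, MeasurableSet (S ⁻¹' idxEvent T (unitCube d) j) := fun j =>
    hS (measurableSet_idxEvent hT measurableSet_unitCube j)
  have hpd : ∀ j, Measurable fun ω => pdIdx (S ω).1 j := fun j => (measurable_pdIdx j).comp hS
  have h1 : ∀ ω, pdCount (S ω).1 T (unitCube d) =
      ∑' j, (S ⁻¹' idxEvent T (unitCube d) j).indicator (1 : Ω → ℝ≥0∞) ω := fun ω =>
    pdCount_eq_tsum _ _ _
  simp only [h1]
  rw [distLaw, Measure.sum_apply _ hT, lintegral_tsum fun j =>
    (measurable_one.indicator (hm j)).aemeasurable]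
  refine tsum_congr fun j => ?_
  rw [Measure.map_apply (hpd j) hT, Measure.restrict_apply (hpd j hT),
    lintegral_indicator_one (hm j)]
  congr 1
  ext ω
  simp only [idxEvent, Set.mem_inter_iff, Set.mem_preimage, Set.mem_ofPred_eq, Set.mem_univ,
    and_true]
  tauto

lemma lintegral_natCast_poissonMeasure_one :
    ∫⁻ n : ℕ, (n : ℝ≥0∞) ∂(poissonMeasure 1) = 1 := by
  have hp : ∀ n : ℕ, ((n + 1 : ℕ) : ℝ≥0∞) * poissonMeasure 1 {n + 1} = poissonMeasure 1 {n} := by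
    intro n
    rw [poissonMeasure_singleton, poissonMeasure_singleton, ← ENNReal.ofReal_natCast,
      ← ENNReal.ofReal_mul (by positivity), Nat.factorial_succ]
    congr 1
    push_cast
    field_simp
    simp
  rw [lintegral_countable', tsum_eq_zero_add' ENNReal.summable]
  simp only [hp, Nat.cast_zero, zero_mul, zero_add]
  rw [← measure_iUnion (fun i j hij => Set.disjoint_singleton.2 hij)
    (fun n => measurableSet_singleton n), Set.iUnion_of_singleton, measure_univ]

lemma IsUnitPoissonProcess.isProbabilityMeasure_distLaw [IsProbabilityMeasure P]
    (hS : IsUnitPoissonProcess P fun ω => (S ω).1) : IsProbabilityMeasure (distLaw P S) := by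
  refine ⟨?_⟩
  rw [distLaw_apply hS.measurable_config MeasurableSet.univ]
  simp only [pdCount_univ]
  have h := hS.map_cnt (B := unitCube d) measurableSet_unitCube (by simp [volume_unitCube])
  rw [← lintegral_map (f := fun x : ℝ≥0∞ => x) measurable_id
    (hS.measurable_cnt measurableSet_unitCube), h,
    lintegral_map (f := fun x : ℝ≥0∞ => x) measurable_id (measurable_of_countable _), volume_unitCube]
  exact lintegral_natCast_poissonMeasure_one

lemma IsUnitPoissonProcess.tail_le (hd : 1 ≤ d) [IsProbabilityMeasure P]
    (hS : IsUnitPoissonProcess P fun ω => (S ω).1) {r : ℝ} {K : ℕ} (hK : √d * K < r) :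
    (K : ℝ≥0∞) ^ d * distLaw P S (Set.Ioi (ENNReal.ofReal r)) ≤ 1 := by
  set T := Set.Ioi (ENNReal.ofReal r) with hT
  have hTm : MeasurableSet T := measurableSet_Ioi
  let vec : (Fin d → Fin K) → Fin d → ℤ := fun v i => (v i : ℕ)
  have hvec : Function.Injective vec := fun v w h => by
    funext i
    have := congrFun h i
    simp only [vec, Nat.cast_inj] at this
    exact Fin.ext this
  have hsum : ∑ v : Fin d → Fin K, ∫⁻ ω, pdCount (S ω).1 T (cube 0 (vec v)) ∂P =
      (K : ℝ≥0∞) ^ d * distLaw P S T := by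
    simp only [hS.lintegral_pdCount_cube hTm, ← distLaw_apply hS.measurable_config hTm]
    simp
  have hmeas : ∀ v, Measurable fun ω => pdCount (S ω).1 T (cube 0 (vec v)) := fun v =>
    (measurable_pdCount hTm (measurableSet_cube 0 (vec v))).comp hS.measurable_config
  rw [← hsum, ← lintegral_finsetSum _ fun v _ => hmeas v]
  calc _ ≤ ∫⁻ _ω, 1 ∂P := by
        refine lintegral_mono_ae ?_
        filter_upwards [hS.ae_good hd] with ω hω
        have hdisj : Pairwise fun v w => Disjoint
            {x | x ∈ (S ω).1 ∩ cube 0 (vec v) ∧ pd (S ω).1 x ∈ T}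
            {x | x ∈ (S ω).1 ∩ cube 0 (vec w) ∧ pd (S ω).1 x ∈ T} := fun v w hvw =>
          (disjoint_cube (hvec.ne hvw)).mono (fun x hx => hx.1.2) fun x hx => hx.1.2
        have := encard_iUnion_eq_tsum hdisj
        rw [tsum_fintype] at this
        simp only [pdCount]
        rw [← this, ← ENat.toENNReal_one, ENat.toENNReal_le, Set.encard_le_one_iff]
        intro x y hx hy
        obtain ⟨v, ⟨hxU, hxv⟩, hxT⟩ := Set.mem_iUnion.1 hx
        obtain ⟨w, ⟨hyU, hyw⟩, hyT⟩ := Set.mem_iUnion.1 hy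
        by_contra hxy
        have hbound : ∀ (u : Fin d → Fin K) (z : Space d), z ∈ cube 0 (vec u) →
            ∀ i, 0 ≤ z i ∧ z i ≤ K := by
          intro u z hz i
          have := congrFun hz i
          simp only [cell, pow_zero, one_mul, vec, Int.floor_eq_iff, Int.cast_natCast] at this
          have h1 : ((u i : ℕ) : ℝ) + 1 ≤ K := by exact_mod_cast (u i).2
          exact ⟨(Nat.cast_nonneg _).trans this.1, (this.2.trans_le h1).le⟩
        have hdist : dist x y ≤ √d * K := dist_le_sqrt_mul (Nat.cast_nonneg K) fun i => by
          have h1 := hbound v x hxv i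
          have h2 := hbound w y hyw i
          rw [abs_le]
          constructor <;> linarith
        have hle := le_edist_of_far hω hxU hyU hxy hxT hyT
        rw [edist_dist, ENNReal.ofReal_le_ofReal_iff dist_nonneg] at hle
        linarith
    _ = 1 := by simp

lemma IsUnitPoissonProcess.distLaw_Ioi_le (hd : 1 ≤ d) [IsProbabilityMeasure P]
    (hS : IsUnitPoissonProcess P fun ω => (S ω).1) {r : ℝ} (hr : 0 < r) :
    distLaw P S (Set.Ioi (ENNReal.ofReal r)) ≤ ENNReal.ofReal ((4 * √d) ^ d / r ^ d) := by
  have := hS.isProbabilityMeasure_distLaw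
  have hd0 : (0 : ℝ) < √d := Real.sqrt_pos.2 (by exact_mod_cast hd)
  rw [← div_pow]
  by_cases hsmall : r ≤ 4 * √d
  · refine prob_le_one.trans ?_
    rw [← ENNReal.ofReal_one]
    exact ENNReal.ofReal_le_ofReal (one_le_pow₀ ((one_le_div hr).2 hsmall))
  · push Not at hsmall
    set K := ⌊r / (2 * √d)⌋₊ with hK
    have hK1 : (K : ℝ) ≤ r / (2 * √d) := Nat.floor_le (by positivity)
    have hK2 : r / (2 * √d) < K + 1 := Nat.lt_floor_add_one _
    have hK3 : r / (4 * √d) ≤ K := by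
      have h1 : 1 ≤ r / (4 * √d) := (one_le_div (by positivity)).2 hsmall.le
      have h2 : r / (2 * √d) = 2 * (r / (4 * √d)) := by field_simp; norm_num
      linarith
    have hK4 : √d * K < r := by
      rw [le_div_iff₀ (by positivity)] at hK1
      nlinarith
    have hK0 : (0 : ℝ) < K := lt_of_lt_of_le (by positivity) hK3
    have h := hS.tail_le hd hK4
    have hKd : (K : ℝ≥0∞) ^ d = ENNReal.ofReal ((K : ℝ) ^ d) := by
      rw [ENNReal.ofReal_pow hK0.le, ENNReal.ofReal_natCast]
    rw [hKd, mul_comm, ← ENNReal.le_div_iff_mul_le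
      (Or.inl (ENNReal.ofReal_pos.2 (pow_pos hK0 d)).ne') (Or.inl ENNReal.ofReal_ne_top),
      ← ENNReal.ofReal_one, ← ENNReal.ofReal_div_of_pos (by positivity)] at h
    refine h.trans (ENNReal.ofReal_le_ofReal ?_)
    rw [← one_div_pow]
    refine pow_le_pow_left₀ (by positivity) ?_ d
    rw [div_le_div_iff₀ hK0 hr]
    rw [div_le_iff₀ (by positivity)] at hK3
    linarith

lemma IsUnitPoissonProcess.distLaw_top (hd : 1 ≤ d) [IsProbabilityMeasure P]
    (hS : IsUnitPoissonProcess P fun ω => (S ω).1) : distLaw P S {∞} = 0 := by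
  have hlim : Filter.Tendsto (fun n : ℕ => ENNReal.ofReal ((4 * √d) ^ d / ((n : ℝ) + 1) ^ d))
      Filter.atTop (nhds (ENNReal.ofReal 0)) := by
    refine (ENNReal.continuous_ofReal.tendsto 0).comp ?_
    refine Filter.Tendsto.div_atTop tendsto_const_nhds ?_
    exact (Filter.tendsto_pow_atTop (by omega)).comp
      (Filter.tendsto_atTop_add_const_right _ 1 tendsto_natCast_atTop_atTop)
  rw [ENNReal.ofReal_zero] at hlim
  refine le_antisymm (ge_of_tendsto' hlim fun n => ?_) zero_le
  refine (measure_mono ?_).trans (hS.distLaw_Ioi_le hd (r := n + 1) (by positivity))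
  rintro _ rfl
  exact ENNReal.ofReal_lt_top

lemma IsUnitPoissonProcess.ae_pd_ne_top (hd : 1 ≤ d) [IsProbabilityMeasure P]
    (hS : IsUnitPoissonProcess P fun ω => (S ω).1) :
    ∀ᵐ ω ∂P, ∀ x ∈ (S ω).1, pd (S ω).1 x ≠ ∞ := by
  have h : ∀ v : Fin d → ℤ, ∀ᵐ ω ∂P, pdCount (S ω).1 {∞} (cube 0 v) = 0 := by
    intro v
    have hT : MeasurableSet ({∞} : Set ℝ≥0∞) := measurableSet_singleton _
    refine (lintegral_eq_zero_iff ((measurable_pdCount hT (measurableSet_cube 0 v)).comp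
      hS.measurable_config)).1 ?_
    have h2 := hS.lintegral_pdCount_cube hT v
    rw [← distLaw_apply hS.measurable_config hT, hS.distLaw_top hd] at h2
    exact h2
  filter_upwards [ae_all_iff.2 h] with ω hω x hx hpd
  have h0 := hω (cell 0 x)
  rw [pdCount, ENat.toENNReal_eq_zero, Set.encard_eq_zero] at h0
  exact (h0 ▸ (⟨⟨hx, rfl⟩, hpd⟩ : x ∈ {y | y ∈ (S ω).1 ∩ cube 0 (cell 0 x) ∧
    pd (S ω).1 y ∈ ({∞} : Set ℝ≥0∞)}) : x ∈ (∅ : Set (Space d)))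

/-! ### The moment of order `d` -/

lemma norm_le_of_mem_unitCube {x : Space d} (hx : x ∈ unitCube d) : ‖x‖ ≤ √d := by
  rw [unitCube_eq_cube] at hx
  have h0 : cell 0 (0 : Space d) = 0 := by funext i; simp [cell]
  have := dist_le_of_cell_eq (n := 0) (x := x) (y := 0) (hx.trans h0.symm)
  simpa using this

lemma cell_latticePoint (v : Fin d → ℤ) : cell 0 (latticePoint v) = v := by
  funext i; simp [cell, latticePoint]

lemma dist_latticePoint_le {x : Space d} {v : Fin d → ℤ} (hx : x ∈ cube 0 v) :
    dist x (latticePoint v) ≤ √d := by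
  simpa using dist_le_of_cell_eq (n := 0) (hx.trans (cell_latticePoint v).symm)

/-- The lattice points of norm less than `t + c`. -/
def latticeBall (d : ℕ) (c : ℝ) (t : ℝ≥0∞) : Set (Fin d → ℤ) :=
  {v | ENNReal.ofReal ‖(latticePoint v : Space d)‖ < t + ENNReal.ofReal c}

lemma tsum_latticeBall_le (hd : 1 ≤ d) (t : ℝ≥0∞) {c : ℝ} (hc : 0 ≤ c) :
    ∑' v, (latticeBall d c t).indicator (1 : (Fin d → ℤ) → ℝ≥0∞) v ≤
      2 ^ d * (t ^ d + ENNReal.ofReal (c + √d) ^ d) * volume (Metric.ball (0 : Space d) 1) := by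
  have : Nonempty (Fin d) := ⟨⟨0, hd⟩⟩
  have hV : volume (Metric.ball (0 : Space d) 1) ≠ 0 := (Metric.measure_ball_pos _ _ one_pos).ne'
  by_cases ht : t = ∞
  · rw [ht, ENNReal.top_pow (by omega), top_add, ENNReal.mul_top (by simp), ENNReal.top_mul hV]
    exact le_top
  have h1 : (1 : (Fin d → ℤ) → ℝ≥0∞) = fun _ => volume (cube 0 (0 : Fin d → ℤ)) := by
    rw [← unitCube_eq_cube, volume_unitCube]
    rfl
  rw [h1, tsum_indicator_volume_cube]
  have ht0 : 0 ≤ t.toReal := ENNReal.toReal_nonneg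
  have ht' : t = ENNReal.ofReal t.toReal := (ENNReal.ofReal_toReal ht).symm
  have h2 : (cell 0 ⁻¹' latticeBall d c t : Set (Space d)) ⊆
      Metric.closedBall 0 (t.toReal + (c + √d)) := by
    intro x hx
    have hx' : ENNReal.ofReal ‖(latticePoint (cell 0 x) : Space d)‖ < t + ENNReal.ofReal c := hx
    rw [ht', ← ENNReal.ofReal_add ht0 hc,
      ENNReal.ofReal_lt_ofReal_iff_of_nonneg (norm_nonneg _)] at hx'
    have h3 := dist_latticePoint_le (x := x) (v := cell 0 x) rfl
    rw [dist_eq_norm] at h3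
    rw [mem_closedBall_zero_iff]
    have := norm_le_norm_add_norm_sub' x (latticePoint (cell 0 x))
    linarith
  refine (measure_mono h2).trans ?_
  rw [Measure.addHaar_closedBall _ _ (by positivity), finrank_euclideanSpace, Fintype.card_fin]
  gcongr
  rw [ENNReal.ofReal_pow (by positivity), ENNReal.ofReal_add ht0 (by positivity), ← ht']
  set b : ℝ≥0∞ := ENNReal.ofReal (c + √d)
  rcases le_total t b with hab | hab
  · calc (t + b) ^ d ≤ (2 * b) ^ d := by rw [two_mul]; gcongr
      _ ≤ _ := by rw [mul_pow]; gcongr; exact le_add_self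
  · calc (t + b) ^ d ≤ (2 * t) ^ d := by rw [two_mul]; gcongr
      _ ≤ _ := by rw [mul_pow]; gcongr; exact le_self_add

/-- The points of `U` that would not reject a partner in the unit cube. -/
def desiring (U : Set (Space d)) : Set (Space d) :=
  {x | x ∈ U ∧ ENNReal.ofReal ‖x‖ < pd U x + ENNReal.ofReal √d}

lemma IsUnitPoissonProcess.ae_finite_desiring (hd : 1 ≤ d) [IsProbabilityMeasure P]
    (hS : IsUnitPoissonProcess P fun ω => (S ω).1) (h : ∫⁻ x, x ^ d ∂(distLaw P S) ≠ ∞) :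
    ∀ᵐ ω ∂P, (desiring (S ω).1).Finite := by
  classical
  have := hS.isProbabilityMeasure_distLaw
  set T : (Fin d → ℤ) → Set ℝ≥0∞ := fun v =>
    {t | ENNReal.ofReal ‖(latticePoint v : Space d)‖ < t + ENNReal.ofReal (2 * √d)} with hT
  have hTm : ∀ v, MeasurableSet (T v) := fun v =>
    measurableSet_lt measurable_const (measurable_id.add_const _)
  have hmeas : ∀ v, Measurable fun ω => pdCount (S ω).1 (T v) (cube 0 v) := fun v =>
    (measurable_pdCount (hTm v) (measurableSet_cube 0 v)).comp hS.measurable_config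
  have hfin : ∫⁻ ω, ∑' v, pdCount (S ω).1 (T v) (cube 0 v) ∂P ≠ ∞ := by
    rw [lintegral_tsum fun v => (hmeas v).aemeasurable]
    simp only [hS.lintegral_pdCount_cube (hTm _), ← distLaw_apply hS.measurable_config (hTm _)]
    have h1 : ∀ v, distLaw P S (T v) = ∫⁻ t, (T v).indicator 1 t ∂(distLaw P S) := fun v =>
      (lintegral_indicator_one (hTm v)).symm
    simp only [h1]
    rw [← lintegral_tsum fun v => (measurable_one.indicator (hTm v)).aemeasurable]
    refine ne_top_of_le_ne_top ?_ (lintegral_mono fun t =>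
      tsum_latticeBall_le hd t (c := 2 * √d) (by positivity))
    rw [lintegral_mul_const' _ _ measure_ball_lt_top.ne, lintegral_const_mul' _ _ (by simp),
      lintegral_add_right _ measurable_const, lintegral_const, measure_univ, mul_one]
    exact ENNReal.mul_ne_top (ENNReal.mul_ne_top (by simp)
      (ENNReal.add_ne_top.2 ⟨h, by simp⟩)) measure_ball_lt_top.ne
  filter_upwards [ae_lt_top (Measurable.tsum hmeas) hfin] with ω hω
  have hsub : desiring (S ω).1 ⊆
      ⋃ v, {x | x ∈ (S ω).1 ∩ cube 0 v ∧ pd (S ω).1 x ∈ T v} := by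
    rintro x ⟨hx, hlt⟩
    refine Set.mem_iUnion.2 ⟨cell 0 x, ⟨hx, rfl⟩, ?_⟩
    have h1 := dist_latticePoint_le (x := x) (v := cell 0 x) rfl
    rw [dist_comm, dist_eq_norm] at h1
    have h2 := norm_le_norm_add_norm_sub' (latticePoint (cell 0 x)) x
    change ENNReal.ofReal _ < _
    calc _ ≤ ENNReal.ofReal (‖x‖ + √d) := ENNReal.ofReal_le_ofReal (by linarith)
      _ = ENNReal.ofReal ‖x‖ + ENNReal.ofReal √d :=
          ENNReal.ofReal_add (norm_nonneg _) (Real.sqrt_nonneg _)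
      _ < pd (S ω).1 x + ENNReal.ofReal √d + ENNReal.ofReal √d :=
          ENNReal.add_lt_add_right ENNReal.ofReal_ne_top hlt
      _ = _ := by
          rw [add_assoc, ← ENNReal.ofReal_add (Real.sqrt_nonneg _) (Real.sqrt_nonneg _), two_mul]
  refine Set.Finite.subset ?_ hsub
  rw [← Set.encard_lt_top_iff, ← ENat.toENNReal_lt, ENat.toENNReal_top]
  rw [encard_iUnion_eq_tsum]
  · exact hω
  · exact fun v w hvw => (disjoint_cube hvw).mono (fun x hx => hx.1.2) fun x hx => hx.1.2

/-- The union of the unit cube and finitely many dyadic cubes. -/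
noncomputable def region (J : Finset ℕ) : Set (Space d) := unitCube d ∪ ⋃ j ∈ J, dyadic j

lemma measurableSet_region (J : Finset ℕ) : MeasurableSet (region J : Set (Space d)) :=
  measurableSet_unitCube.union (J.measurableSet_biUnion fun j _ => measurableSet_dyadic j)

lemma volume_region_ne_top (J : Finset ℕ) : volume (region J : Set (Space d)) ≠ ∞ := by
  refine (measure_union_lt_top (by simp [volume_unitCube]) ?_).ne
  exact (measure_biUnion_lt_top J.finite_toSet fun j _ => (volume_dyadic_ne_top j).lt_top)

/-- The configurations all of whose points prefer their partners to the points of the unit cube. -/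
def content (d : ℕ) : Set (Config d) :=
  {V | ∀ j, Single V.1 j → pdIdx V.1 j + ENNReal.ofReal √d ≤ ENNReal.ofReal ‖pt V.1 j‖}

lemma measurableSet_content : MeasurableSet (content d) :=
  measurableSet_setOfPred.2 <| Measurable.forall fun j => (measurable_single j).imp <|
    measurableSet_setOfPred.1 <| measurableSet_le ((measurable_pdIdx j).add_const _)
      (measurable_pt j).norm.ennreal_ofReal

lemma mem_content_iff {V : Config d} :
    V ∈ content d ↔ ∀ x ∈ V.1, pd V.1 x + ENNReal.ofReal √d ≤ ENNReal.ofReal ‖x‖ := by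
  rw [forall_mem_iff V.2]
  exact forall_congr' fun j => imp_congr_right fun hj => by rw [pdIdx_eq V.2 hj]

lemma exists_sdiff_region_mem_content {U : Config d} (hU : Good U.1)
    (hfin : (desiring U.1).Finite) : ∃ J, U.sdiff (region J) ∈ content d := by
  classical
  have hst := isStableMatching_matchGraph hU
  set H := desiring U.1 with hH
  set T := H ∪ ⋃ x ∈ H, {y | (matchGraph U.1).Adj x y} with hTdef
  have hTfin : T.Finite := hfin.union (hfin.biUnion fun x _ =>
    Set.Subsingleton.finite fun y hy z hz => hst.1.2 x y z hy hz)
  have hTU : T ⊆ U.1 := by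
    rintro y (hy | hy)
    · exact hy.1
    · obtain ⟨x, _, hxy⟩ := Set.mem_iUnion₂.1 hy
      exact (hst.1.1 x y hxy).2
  have hTadj : ∀ x ∈ T, ∀ y, (matchGraph U.1).Adj x y → y ∈ T := by
    rintro x (hx | hx) y hxy
    · exact Or.inr (Set.mem_iUnion₂.2 ⟨x, hx, hxy⟩)
    · obtain ⟨w, hw, hwx⟩ := Set.mem_iUnion₂.1 hx
      exact Or.inl (hst.1.2 x w y (SimpleGraph.Adj.symm hwx) hxy ▸ hw)
  have hiso : ∀ x ∈ U.1, ∃ j, U.1 ∩ dyadic j = {x} := fun x hx => by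
    obtain ⟨j, hj, rfl⟩ := exists_single U.2 hx
    exact ⟨j, hj.inter_eq⟩
  choose! idx hidx using hiso
  refine ⟨hTfin.toFinset.image idx, ?_⟩
  set D : Set (Space d) := region (hTfin.toFinset.image idx) with hD
  have hTD : T ⊆ D := fun x hx => Or.inr (Set.mem_iUnion₂.2 ⟨idx x,
    Finset.mem_image_of_mem _ (hTfin.mem_toFinset.2 hx),
    ((hidx x (hTU hx)).symm ▸ Set.mem_singleton x : x ∈ U.1 ∩ dyadic (idx x)).2⟩)
  have hDT : ∀ x ∈ U.1, x ∈ D → x ∈ T := by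
    rintro x hx (hxD | hxD)
    · refine Or.inl ⟨hx, ?_⟩
      calc ENNReal.ofReal ‖x‖ ≤ ENNReal.ofReal √d :=
            ENNReal.ofReal_le_ofReal (norm_le_of_mem_unitCube hxD)
        _ < _ := by
            rw [add_comm]
            exact ENNReal.lt_add_right ENNReal.ofReal_ne_top (pd_pos hU x).ne'
    · obtain ⟨j, hj, hxj⟩ := Set.mem_iUnion₂.1 hxD
      obtain ⟨y, hy, rfl⟩ := Finset.mem_image.1 hj
      rw [hTfin.mem_toFinset] at hy
      have : x ∈ ({y} : Set (Space d)) := hidx y (hTU hy) ▸ ⟨hx, hxj⟩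
      rw [Set.mem_singleton_iff.1 this]
      exact hy
  rw [mem_content_iff]
  rintro x hx
  have hx' : x ∈ U.1 \ D := hx
  change pd (U.1 \ D) x + _ ≤ _
  rw [pd_sdiff hU (fun x hxD y hxy => hTD (hTadj x (hDT x (hst.1.1 x y hxy).1 hxD) y hxy)) hx']
  by_contra! hlt
  exact hx'.2 (hTD (Or.inl ⟨hx'.1, hlt⟩))

lemma exists_pd_eq_top_of_content {U : Config d} (hU : Good U.1) {D : Set (Space d)}
    (hD : unitCube d ⊆ D) (hc : U.sdiff D ∈ content d) (h1 : cnt U.1 (unitCube d) = 1)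
    (h0 : cnt U.1 (D \ unitCube d) = 0) : ∃ x ∈ U.1, pd U.1 x = ∞ := by
  rw [← encard_eq_one_iff_cnt, Set.encard_eq_one] at h1
  rw [cnt, ENat.toENNReal_eq_zero, Set.encard_eq_zero] at h0
  obtain ⟨u, hu⟩ := h1
  have huU : u ∈ U.1 ∩ unitCube d := hu ▸ Set.mem_singleton u
  have hUV : U.1 = insert u (U.1 \ D) := by
    ext x
    simp only [Set.mem_insert_iff, Set.mem_sdiff]
    constructor
    · intro hx
      by_cases hxD : x ∈ D
      · left
        by_cases hxQ : x ∈ unitCube d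
        · exact (hu ▸ (⟨hx, hxQ⟩ : x ∈ U.1 ∩ unitCube d) : x ∈ ({u} : Set (Space d)))
        · exact (h0 ▸ (⟨hx, hxD, hxQ⟩ : x ∈ U.1 ∩ (D \ unitCube d)) :
            x ∈ (∅ : Set (Space d))).elim
      · exact Or.inr ⟨hx, hxD⟩
    · rintro (rfl | hx)
      exacts [huU.1, hx.1]
  refine ⟨u, huU.1, ?_⟩
  rw [hUV]
  refine pd_insert_eq_top (hUV ▸ hU) (fun h => h.2 (hD huU.2)) fun x hx => ?_
  have hx2 := mem_content_iff.1 hc x hx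
  change pd (U.1 \ D) x + _ ≤ _ at hx2
  refine (ENNReal.add_le_add_iff_right (a := ENNReal.ofReal √d) ENNReal.ofReal_ne_top).1
    (hx2.trans ?_)
  rw [edist_dist, ← ENNReal.ofReal_add dist_nonneg (Real.sqrt_nonneg _)]
  refine ENNReal.ofReal_le_ofReal ?_
  rw [dist_eq_norm]
  have := norm_le_norm_add_norm_sub' x u
  linarith [norm_le_of_mem_unitCube huU.2]

lemma IsUnitPoissonProcess.lintegral_pow_distLaw (hd : 1 ≤ d) [IsProbabilityMeasure P]
    (hS : IsUnitPoissonProcess P fun ω => (S ω).1) : ∫⁻ x, x ^ d ∂(distLaw P S) = ∞ := by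
  by_contra h
  have hJ : ∃ J : Finset ℕ, P {ω | (S ω).sdiff (region J) ∈ content d} ≠ 0 := by
    by_contra! hJ
    have h1 : P (⋃ J : Finset ℕ, {ω | (S ω).sdiff (region J) ∈ content d}) = 0 :=
      measure_iUnion_null hJ
    have h2 : ∀ᵐ ω ∂P, ω ∈ ⋃ J : Finset ℕ, {ω | (S ω).sdiff (region J) ∈ content d} := by
      filter_upwards [hS.ae_good hd, hS.ae_finite_desiring hd h] with ω hg hf
      exact Set.mem_iUnion.2 (exists_sdiff_region_mem_content hg hf)
    have h3 : ∀ᵐ ω ∂P, False := by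
      filter_upwards [h2, measure_eq_zero_iff_ae_notMem.1 h1] with ω h h'
      exact h' h
    simp at h3
    exact IsProbabilityMeasure.ne_zero P h3
  obtain ⟨J, hJ⟩ := hJ
  refine hS.prob_resample_ne_zero (measurableSet_region J) (volume_region_ne_top J)
    measurableSet_unitCube Set.subset_union_left (by simp [volume_unitCube])
    measurableSet_content hJ ?_
  rw [measure_eq_zero_iff_ae_notMem]
  filter_upwards [hS.ae_good hd, hS.ae_pd_ne_top hd] with ω hg hne hω
  obtain ⟨x, hx, htop⟩ :=
    exists_pd_eq_top_of_content hg Set.subset_union_left hω.1 hω.2.1 hω.2.2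
  exact hne x hx htop

end Typical

/-! ### Locally finite modification -/

section Modification

variable {d : ℕ} {Ω : Type*} [MeasurableSpace Ω] {P : Measure Ω} {R : Ω → Set (Space d)}

open Classical in
/-- The set `U` if it is locally finite and the empty set otherwise. -/
noncomputable def regularize (U : Set (Space d)) : Config d :=
  if h : LocFin U then ⟨U, h⟩ else ⟨∅, fun _ => by simp⟩

lemma regularize_val {U : Set (Space d)} (h : LocFin U) : (regularize U).1 = U := by
  rw [regularize, dif_pos h]

lemma IsUnitPoissonProcess.measurableSet_locFin (hR : IsUnitPoissonProcess P R) :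
    MeasurableSet {ω | LocFin (R ω)} := by
  have : {ω | LocFin (R ω)} = ⋂ n : ℕ, {ω | cnt (R ω) (Metric.closedBall 0 n) < ∞} := by
    ext ω
    simp only [Set.mem_iInter, Set.mem_ofPred_eq, LocFin, cnt]
    refine forall_congr' fun n => ?_
    rw [← Set.encard_lt_top_iff, ← ENat.toENNReal_lt, ENat.toENNReal_top]
  rw [this]
  exact MeasurableSet.iInter fun n => measurableSet_lt
    (hR.measurable_cnt Metric.isClosed_closedBall.measurableSet) measurable_const

lemma IsUnitPoissonProcess.regularize [IsProbabilityMeasure P] (hR : IsUnitPoissonProcess P R) :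
    IsUnitPoissonProcess P fun ω => (regularize (R ω)).1 := by
  classical
  have hae : ∀ B : Set (Space d), (fun ω => (R ω ∩ B).encard) =ᵐ[P]
      fun ω => ((StableMatching.regularize (R ω)).1 ∩ B).encard := fun B => by
    filter_upwards [hR.ae_locFin] with ω hω
    rw [regularize_val hω]
  refine ⟨fun B hB => ?_, fun B hB hv n => ?_, fun k B hB hdisj => ?_⟩
  · have : (fun ω => (((StableMatching.regularize (R ω)).1 ∩ B).encard : ℝ≥0∞)) =
        fun ω => if LocFin (R ω) then ((R ω ∩ B).encard : ℝ≥0∞) else 0 := by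
      funext ω
      by_cases h : LocFin (R ω)
      · rw [if_pos h, regularize_val h]
      · rw [if_neg h, StableMatching.regularize, dif_neg h]
        simp
    rw [this]
    exact Measurable.ite hR.measurableSet_locFin (hR.measurable_count B hB) measurable_const
  · rw [← hR.count_law B hB hv n]
    refine measure_congr ?_
    filter_upwards [hae B] with ω hω
    exact propext (by
      change (_ ∩ B).encard = _ ↔ (R ω ∩ B).encard = _
      rw [← hω])
  · exact (hR.indep_count k B hB hdisj).congr fun i => by
      filter_upwards [hae (B i)] with ω hω
      rw [hω]

end Modification

end StableMatching

theorem mainTheorem7 (d : ℕ) (hd : 1 ≤ d) :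
    ∃ C : ℝ, 0 < C ∧
      ∀ (Ω : Type*) [MeasurableSpace Ω] (P : Measure Ω) [IsProbabilityMeasure P]
        (R : Ω → Set (StableMatching.Space d)),
        StableMatching.IsUnitPoissonProcess P R →
        (∀ᵐ ω ∂P, ∃! m : SimpleGraph (StableMatching.Space d),
          StableMatching.IsStableMatching (R ω) m) ∧
        ∀ M : Ω → SimpleGraph (StableMatching.Space d),
          (∀ᵐ ω ∂P, StableMatching.IsStableMatching (R ω) (M ω)) →
          (∀ᵐ ω ∂P, StableMatching.MatchesAll (R ω) (M ω)) ∧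
          ∃ μ : Measure ℝ≥0∞, StableMatching.IsTypicalDistLaw P R M μ ∧
            ∫⁻ x, x ^ d ∂μ = ∞ ∧
            ∀ r : ℝ, 0 < r → μ (Set.Ioi (ENNReal.ofReal r)) ≤ ENNReal.ofReal (C / r ^ d) := by
  open StableMatching in
  have hd0 : (0 : ℝ) < √d := Real.sqrt_pos.2 (by exact_mod_cast hd)
  refine ⟨(4 * √d) ^ d, by positivity, fun Ω _ P _ R hR => ⟨?_, fun M hM => ?_⟩⟩
  · filter_upwards [hR.ae_good hd] with ω hω using hω.existsUnique
  set S : Ω → Config d := fun ω => regularize (R ω) with hSdef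
  have hS : IsUnitPoissonProcess P fun ω => (S ω).1 := hR.regularize
  have hSR : ∀ᵐ ω ∂P, R ω = (S ω).1 ∧ M ω = matchGraph (S ω).1 := by
    filter_upwards [hR.ae_good hd, hM] with ω hg hm
    have h : (S ω).1 = R ω := regularize_val hg.locFin
    exact ⟨h.symm, h ▸ hm.eq_matchGraph hg⟩
  have hcount : ∀ r : ℝ≥0∞, (fun ω => closeCount (R ω) (M ω) r) =ᵐ[P]
      fun ω => pdCount (S ω).1 (Set.Iic r) (unitCube d) := fun r => by
    filter_upwards [hSR] with ω hω
    rw [hω.1, hω.2]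
    rfl
  refine ⟨?_, distLaw P S, ⟨fun r => ?_, hS.isProbabilityMeasure_distLaw, fun r => ?_⟩,
    hS.lintegral_pow_distLaw hd, fun r hr => hS.distLaw_Ioi_le hd hr⟩
  · filter_upwards [hSR, hS.ae_pd_ne_top hd] with ω hω hne x hx
    rw [hω.1] at hx
    rw [hω.2]
    exact exists_adj_of_pd_ne_top (hne x hx)
  · exact ((measurable_pdCount measurableSet_Iic measurableSet_unitCube).comp
      hS.measurable_config).aemeasurable.congr (hcount r).symm
  · rw [distLaw_apply hS.measurable_config measurableSet_Iic, lintegral_congr_ae (hcount r)]
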